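/- Fix $d\ge 1$ and a hypergraph $\Gamma$ of arity three on $\mathbb{R}^d$, i.e. a set of three-element subsets (hyperedges) of $\mathbb{R}^d$. Suppose that $\Gamma$ is *algebraic*: there is a polynomial $p$ in $3d$ variables with real coefficients such that the hyperedges are exactly the sets $\{x_0,x_1,x_2\}$ of three distinct points with $p(x_0,x_1,x_2)=0$. Suppose also that $\Gamma$ is *$2$-irreflexive*: the closure of $\Gamma$ in the space of subsets of $\mathbb{R}^d$ of cardinality at most $3$, with the Vietoris topology, contains no set of cardinality two. For $A\subseteq\mathbb{R}$ and $x\in\mathbb{R}^d$, let $D(A,x)$ be the smallest real algebraic set containing $x$ that is definable in the ordered field $\mathbb{R}$ by a first order formula with parameters in $A$. Let $\varepsilon(A,x)\in[0,\infty]$ be the largest $\varepsilon>0$ for which there is no set $b\subseteq\mathbb{R}^d$ of points at distance less than $\varepsilon$ from $x$ such that $b\cup\{y\}\in\Gamma$ for every $y\in D(A,x)\setminus(b\cup\{x\})$; put $\varepsilon(A,x)=0$ if no such $\varepsilon$ exists and $\varepsilon(A,x)=\infty$ if there are arbitrarily large ones. Let $I$ be the ideal of those sets of positive rationals that have no accumulation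 point in $\mathbb{R}$ other than $0$. The *coloring poset* $P$ consists of all partial functions $p$ from $\mathbb{R}^d$ to the set of open Euclidean balls with rational center and positive rational radius, such that - $\mathrm{dom}(p)=\mathrm{supp}(p)^d$ for some countable real closed subfield $\mathrm{supp}(p)$ of $\mathbb{R}$ (which is then unique); - $x\in p(x)$ for every $x\in\mathrm{dom}(p)$; - $p$ is not constant on any hyperedge $e\in\Gamma$ with $e\subseteq\mathrm{dom}(p)$. For $p,q\in P$, put $q\le p$ if 1. $p\subseteq q$; 2. $\mathrm{diam}(q(x))<\varepsilon(\mathrm{supp}(p),x)$ for every $x\in\mathrm{dom}(q)\setminus\mathrm{dom}(p)$; 3. for every finite set $a\subseteq\mathrm{supp}(q)$, the set of all numbers $\mathrm{diam}(q(x))$, where $x\in\mathrm{dom}(q)\setminus\mathrm{dom}(p)$ and $\varepsilon(\mathrm{supp}(p)\cup a,x)\le\mathrm{diam}(q(x))$, belongs to $I$. Then: - (transitivity) if $r\le q$ and $q\le p$ in $P$, then $r\le p$; - ($\sigma$-closure) for every sequence $p_0\ge p_1\ge p_2\ge\cdots$ in $P$ there is $q\in P$ with $q\le p_i$ for all $i$;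 - (density) for every $p\in P$ and every $x\in\mathbb{R}^d$ there is $q\in P$ with $q\le p$ and $x\in\mathrm{dom}(q)$. -/

import Mathlib

open scoped ENNReal Topology
open FirstOrder

namespace ColoringPoset

/-- The Euclidean space of dimension `d`. -/
abbrev Euc (d : ℕ) : Type := EuclideanSpace ℝ (Fin d)

/-! ### Algebraic and semialgebraic sets -/

/-- A set is algebraic if it is the zero set of a polynomial with real coefficients. -/
def IsAlgebraicSet {d : ℕ} (S : Set (Euc d)) : Prop :=
  ∃ p : MvPolynomial (Fin d) ℝ, S = {z | MvPolynomial.eval (fun i => z i) p = 0}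

/-- The language of real closed fields (ordered rings). -/
abbrev rcfLanguage : Language := Language.ring.sum Language.order

/-- The reals with their standard ring operations, as a structure for the language of rings. -/
noncomputable instance realCompatibleRing : FirstOrder.Ring.CompatibleRing ℝ :=
  FirstOrder.Ring.compatibleRingOfRing ℝ

/-- The reals with their standard order, as a structure for the language of orders. -/
instance realOrderStructure : Language.order.Structure ℝ :=
  Language.orderStructure ℝ

/-- `S` is `F`-semialgebraic: it is defined in the ordered field of the reals by a first order
formula of the language of real closed fields with parameters in `F`. -/
def IsSemialgebraicOver {d : ℕ} (F : Set ℝ) (S : Set (Euc d)) : Prop :=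
  F.Definable rcfLanguage {v : Fin d → ℝ | WithLp.toLp 2 v ∈ S}

/-- The algebraic sets containing `x` which happen to be `F`-semialgebraic. -/
def algFamily {d : ℕ} (F : Set ℝ) (x : Euc d) : Set (Set (Euc d)) :=
  {S | IsSemialgebraicOver F S ∧ IsAlgebraicSet S ∧ x ∈ S}

/-- `D(F, x)`: the smallest member of `algFamily F x`, see `isLeast_D`. -/
def D {d : ℕ} (F : Set ℝ) (x : Euc d) : Set (Euc d) :=
  ⋂₀ algFamily F x

theorem algFamily_inter {d : ℕ} {F : Set ℝ} {x : Euc d} {S T : Set (Euc d)}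
    (hS : S ∈ algFamily F x) (hT : T ∈ algFamily F x) : S ∩ T ∈ algFamily F x := by
  obtain ⟨hS1, ⟨p, hp⟩, hS3⟩ := hS
  obtain ⟨hT1, ⟨q, hq⟩, hT3⟩ := hT
  refine ⟨hS1.inter hT1, ⟨p * p + q * q, ?_⟩, hS3, hT3⟩
  ext z
  rw [hp, hq]
  simp only [Set.mem_inter_iff, Set.mem_ofPred_eq, map_add, map_mul]
  constructor
  · rintro ⟨h1, h2⟩
    rw [h1, h2]
    ring
  · intro h
    constructor <;>
      nlinarith [mul_self_nonneg (MvPolynomial.eval (fun i => z i) p),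
        mul_self_nonneg (MvPolynomial.eval (fun i => z i) q)]

theorem univ_mem_algFamily {d : ℕ} (F : Set ℝ) (x : Euc d) :
    (Set.univ : Set (Euc d)) ∈ algFamily F x :=
  ⟨Set.definable_univ, ⟨0, by ext z; simp⟩, Set.mem_univ x⟩

/-- `D(F, x)` is indeed the smallest `F`-semialgebraic set containing `x` which is algebraic. -/
theorem isLeast_D {d : ℕ} (F : Set ℝ) (x : Euc d) : IsLeast (algFamily F x) (D F x) := by
  let I : Set (Euc d) → Ideal (MvPolynomial (Fin d) ℝ) := fun S =>
    { carrier := {p | ∀ z ∈ S, MvPolynomial.eval (fun i => z i) p = 0}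
      add_mem' := fun {a b} ha hb z hz => by rw [map_add, ha z hz, hb z hz, add_zero]
      zero_mem' := fun z _ => map_zero _
      smul_mem' := fun c a ha z hz => by rw [smul_eq_mul, map_mul, ha z hz, mul_zero] }
  obtain ⟨J, ⟨S, hS, rfl⟩, hmax⟩ := set_has_maximal_iff_noetherian.mpr
    (inferInstance : IsNoetherian (MvPolynomial (Fin d) ℝ) (MvPolynomial (Fin d) ℝ))
    (I '' algFamily F x) ⟨_, Set.mem_image_of_mem I (univ_mem_algFamily F x)⟩
  have hle : ∀ T ∈ algFamily F x, S ⊆ T := by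
    intro T hT z hz
    have hmono : I S ≤ I (S ∩ T) := fun p hp w hw => hp w hw.1
    have heq : I S = I (S ∩ T) := by
      by_contra hne
      exact hmax _ ⟨_, algFamily_inter hS hT, rfl⟩ (lt_of_le_of_ne hmono hne)
    obtain ⟨t, ht⟩ := hT.2.1
    have htm : t ∈ I (S ∩ T) := fun w hw => by
      have := hw.2
      rw [ht] at this
      exact this
    rw [← heq] at htm
    rw [ht]
    exact htm z hz
  have hDS : D F x = S :=
    Set.Subset.antisymm (Set.sInter_subset_of_mem hS) (Set.subset_sInter hle)
  rw [hDS]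
  exact ⟨hS, fun T hT => hle T hT⟩

/-! ### Hypergraphs, given by their sets of hyperedges -/

/-- `Γ` is an algebraic hypergraph of arity three: for some polynomial `p` in `3 * d` variables with
real coefficients, the hyperedges are exactly the sets `{x₀, x₁, x₂}` of three distinct points
such that `p (x₀, x₁, x₂) = 0`. -/
def IsAlgebraicHypergraph {d : ℕ} (Γ : Set (Set (Euc d))) : Prop :=
  ∃ p : MvPolynomial (Fin 3 × Fin d) ℝ, ∀ e : Set (Euc d), e ∈ Γ ↔
    ∃ x : Fin 3 → Euc d, Function.Injective x ∧ Set.range x = e ∧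
      MvPolynomial.eval (fun k => x k.1 k.2) p = 0

/-- `Γ`, of arity `n`, is `2`-irreflexive: the closure of `Γ` in the space of the subsets of `X` of
cardinality at most `n`, with the Vietoris topology, contains no set of cardinality two. -/
def TwoIrreflexive {X : Type*} [TopologicalSpace X] (n : ℕ) (Γ : Set (Set X)) : Prop :=
  letI : TopologicalSpace (Set X) := TopologicalSpace.vietoris X
  ∀ K ∈ closure {e : {s : Set X // s.encard ≤ n} | e.1 ∈ Γ}, K.1.encard ≠ 2

/-! ### The parameter `ε` -/

/-- No set `b` of points closer than `ε` to `x` is such that `b ∪ {y}` is a hyperedge for all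
`y ∈ D(A, x)` outside of `b ∪ {x}`. -/
def IsGoodRadius {d : ℕ} (Γ : Set (Set (Euc d))) (A : Set ℝ) (x : Euc d) (ε : ℝ) : Prop :=
  ¬ ∃ b : Set (Euc d), (∀ z ∈ b, dist z x < ε) ∧
    ∀ y ∈ D A x, y ≠ x → y ∉ b → b ∪ {y} ∈ Γ

/-- `ε(A, x)`: the largest good radius; zero if there is none, `∞` if there are arbitrarily
large ones. -/
noncomputable def eps {d : ℕ} (Γ : Set (Set (Euc d))) (A : Set ℝ) (x : Euc d) : ℝ≥0∞ :=
  ⨆ ε ∈ {ε : ℝ | 0 < ε ∧ IsGoodRadius Γ A x ε}, ENNReal.ofReal ε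

/-! ### The coloring poset -/

/-- The colors: open balls with rational center and (positive) rational radius. -/
def IsColor {d : ℕ} (U : Set (Euc d)) : Prop :=
  ∃ (c : Fin d → ℚ) (r : ℚ), 0 < r ∧
    U = Metric.ball (WithLp.toLp 2 (fun i => (c i : ℝ)) : Euc d) (r : ℝ)

/-- The domain of a partial map. -/
def domain {α β : Type*} (f : α → Option β) : Set α :=
  {x | ∃ U, f x = some U}

/-- Partial `Γ`-colorings: the values are colors, each point belongs to its color, and no
hyperedge included in the domain is monochromatic. -/
structure IsPartialColoring {d : ℕ} (Γ : Set (Set (Euc d)))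
    (f : Euc d → Option (Set (Euc d))) : Prop where
  isColor : ∀ x U, f x = some U → IsColor U
  mem_color : ∀ x U, f x = some U → x ∈ U
  not_monochromatic : ∀ e ∈ Γ, e ⊆ domain f → ¬ ∃ U, ∀ x ∈ e, f x = some U

/-- The ideal `I`: sets of positive rationals with no accumulation point other than zero. -/
def MemIdeal (A : Set ℝ) : Prop :=
  (∀ t ∈ A, ∃ r : ℚ, 0 < r ∧ t = r) ∧ ∀ y : ℝ, AccPt y (Filter.principal A) → y = 0

/-- The conditions of the coloring poset. For `d ≥ 1` the field `supp` is determined by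
the domain of the coloring. -/
structure Condition {d : ℕ} (Γ : Set (Set (Euc d))) where
  /-- the underlying partial coloring -/
  color : Euc d → Option (Set (Euc d))
  /-- the support -/
  supp : Subfield ℝ
  isPartialColoring : IsPartialColoring Γ color
  countable_supp : (supp : Set ℝ).Countable
  isRealClosed_supp : IsRealClosed supp
  domain_color : domain color = {x | ∀ i, x i ∈ supp}

namespace Condition

variable {d : ℕ} {Γ : Set (Set (Euc d))}

/-- The domain of a condition. -/
def dom (p : Condition Γ) : Set (Euc d) := domain p.color

/-- The set `C(p, q, a)` of the points `x` in `dom (q \ p)` such that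
`ε(supp p ∪ a, x) ≤ diam (q x)`. -/
def C (p q : Condition Γ) (a : Set ℝ) : Set (Euc d) :=
  {x | x ∈ q.dom \ p.dom ∧ ∃ U, q.color x = some U ∧
    eps Γ ((p.supp : Set ℝ) ∪ a) x ≤ ENNReal.ofReal (Metric.diam U)}

/-- The set of the diameters of the values of `q` at the points of `A`. -/
def diams (q : Condition Γ) (A : Set (Euc d)) : Set ℝ :=
  {t | ∃ x ∈ A, ∃ U, q.color x = some U ∧ t = Metric.diam U}

/-- The ordering of the coloring poset: `q ≤ p`, in words `q` is stronger than `p`. -/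
instance : LE (Condition Γ) where
  le q p :=
    (∀ x U, p.color x = some U → q.color x = some U) ∧
    (∀ x ∈ q.dom \ p.dom, ∀ U, q.color x = some U →
      ENNReal.ofReal (Metric.diam U) < eps Γ (p.supp : Set ℝ) x) ∧
    (∀ a : Set ℝ, a.Finite → a ⊆ (q.supp : Set ℝ) → MemIdeal (q.diams (C p q a)))

end Condition

end ColoringPoset

/-!
The order of the poset involves the parameter `ε(A, x)`, which decreases as `A` grows since
`D(A, x)` does. Everything rests on the model theory of the ordered field of the reals over a subfield `F`
which is real closed, equivalently relatively algebraically closed in the reals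
(`mem_of_isAlgebraic`, `isRealClosed_of_forall_isAlgebraic`). Quantifier elimination, obtained from
the sign elimination `signsEliminable` in the manner of Muchnik, has two consequences: a nonempty
set definable over such an `F` has a point with coordinates in `F` (`exists_mem_of_definable`), and
a set definable over `K` is a neighborhood of each of its points which are generic over `K`
(`mem_nhds_of_algebraicIndependent`).

Transitivity is delicate only in the third clause of the order, where the parameters `a` lie in the
support of the strongest condition `r` and not of the middle one `q`. At the points of the domain
of `q`, finitely many parameters from the support of `q` serve as well as `a`, in the sense that
they give a smaller `D` and so a larger `ε` (`exists_finite_D_subset`). The set of diameters in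
question is then included in the union of a set given by `r ≤ q` and one given by `q ≤ p`.

For `σ`-closure, the union of the sequence is a lower bound: a finite set of parameters already
belongs to some support, and the points added after that stage have colors of diameter less than
the relevant `ε` by the second clause of the order (`Condition.exists_le_of_antitone`).

For density, the support is enlarged to a countable real closed field over which `x` is rational.
The new points get balls of pairwise different diameters of the form `1 / 2 ^ k`, so that the
third clause is immediate. Irreflexivity gives that `ε(F, y)` is positive at every new point `y`
(`eps_pos`), and that `y` has a neighborhood in which no two points over `F` form a hyperedge with
it (`exists_radius_not_mem`). If the ball of `y` is small with respect to both bounds, then the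
second clause holds and no hyperedge becomes monochromatic, since only one new point could occur
in such a hyperedge (`Condition.exists_le_mem_dom`).
-/

namespace ColoringPoset

/-! ### Real closed subfields of the reals -/

section RealClosed

open Module IntermediateField

/-- Over a real closed field, `a + b * i` has a square root `u + v * i`. -/
theorem exists_complex_sqrt {F : Type*} [Field F] [LinearOrder F] [IsStrictOrderedRing F]
    [IsRealClosed F] (a b : F) : ∃ u v : F, u * u - v * v = a ∧ 2 * u * v = b := by
  by_cases hb : b = 0
  · subst hb
    rcases IsRealClosed.isSquare_or_isSquare_neg a with ⟨s, hs⟩ | ⟨s, hs⟩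
    · exact ⟨s, 0, by rw [hs]; ring, by ring⟩
    · exact ⟨0, s, by linear_combination hs, by ring⟩
  · obtain ⟨r, hr⟩ := IsSquare.of_nonneg (R := F) (x := a * a + b * b)
      (add_nonneg (mul_self_nonneg a) (mul_self_nonneg b))
    wlog hr0 : 0 ≤ r generalizing r
    · exact this (-r) (by rw [hr]; ring) (by linarith)
    have hb2 : 0 < b * b := mul_self_pos.mpr hb
    have hra : 0 < r + a := by
      by_contra hcon
      push Not at hcon
      nlinarith
    obtain ⟨u, hu⟩ := IsSquare.of_nonneg (R := F) (x := (r + a) / 2) (by linarith)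
    have hu0 : u ≠ 0 := by
      rintro rfl
      linarith
    refine ⟨u, b / (2 * u), ?_, by field_simp⟩
    have hu2 : 2 * (u * u) = r + a := by linarith
    field_simp
    have h4 : b ^ 2 = r * r - a * a := by linear_combination hr
    rw [h4]
    linear_combination (2 * (u * u) + r - a) * hu2

/-- The degree of a finite Galois extension of a real closed field is a power of two: the fixed
field of a Sylow `2`-subgroup has odd degree, and so it is generated by a root of an irreducible
polynomial of odd degree, which has a root in the base field. -/
theorem exists_finrank_eq_two_pow {F L : Type*} [Field F] [CharZero F] [IsRealClosed F] [Field L]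
    [Algebra F L] [FiniteDimensional F L] [IsGalois F L] : ∃ k, finrank F L = 2 ^ k := by
  have odd_case : ∀ E : IntermediateField F L, Odd (finrank F E) → finrank F E = 1 := by
    intro E hE
    obtain ⟨α, hα⟩ := Field.exists_primitive_element F E
    have hint : IsIntegral F α := Algebra.IsIntegral.isIntegral α
    have hdeg : (minpoly F α).natDegree = finrank F E := by
      rw [← IntermediateField.adjoin.finrank hint, hα, IntermediateField.finrank_top']
    obtain ⟨x, hx⟩ := IsRealClosed.exists_isRoot_of_odd_natDegree (R := F) (f := minpoly F α)
      (by rw [hdeg]; exact hE)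
    rw [← hdeg]
    exact Polynomial.natDegree_eq_of_degree_eq_some
      (Polynomial.degree_eq_one_of_irreducible_of_root (minpoly.irreducible hint) hx)
  let P : Sylow 2 Gal(L/F) := default
  have hidx : finrank F (fixedField (P : Subgroup Gal(L/F))) = (P : Subgroup Gal(L/F)).index := by
    rw [IntermediateField.finrank_eq_fixingSubgroup_index, fixingSubgroup_fixedField]
  have h1 : (P : Subgroup Gal(L/F)).index = 1 := by
    rw [← hidx]
    apply odd_case
    rw [hidx, ← Nat.not_even_iff_odd, even_iff_two_dvd]
    exact P.not_dvd_index
  obtain ⟨k, hk⟩ := (IsPGroup.iff_card (p := 2)).mp P.isPGroup'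
  refine ⟨k, ?_⟩
  rw [← IsGalois.card_aut_eq_finrank, ← hk, ← Subgroup.card_mul_index (P : Subgroup Gal(L/F)), h1,
    mul_one]

/-- A Galois extension of degree a power of two is trivial when the base field has no quadratic
extension, as otherwise a subgroup of index two gives one. -/
theorem finrank_eq_one_of_forall_isSquare {k L : Type*} [Field k] [CharZero k]
    (hsq : ∀ x : k, IsSquare x) [Field L] [Algebra k L] [FiniteDimensional k L] [IsGalois k L]
    {n : ℕ} (hn : finrank k L = 2 ^ n) : finrank k L = 1 := by
  rcases n with _ | n
  · simpa using hn
  exfalso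
  obtain ⟨H, hH⟩ := Sylow.exists_subgroup_card_pow_prime (G := Gal(L/k)) 2 (n := n)
    (by rw [IsGalois.card_aut_eq_finrank, hn]; exact pow_dvd_pow 2 n.le_succ)
  have h2 : finrank k (fixedField H) = 2 := by
    have h3 := finrank_mul_finrank k (fixedField H) L
    rw [finrank_fixedField_eq_card, hH, hn, pow_succ'] at h3
    exact Nat.eq_of_mul_eq_mul_right (by positivity) h3
  obtain ⟨α, hα⟩ := Field.exists_primitive_element k (fixedField H)
  have hint : IsIntegral k α := Algebra.IsIntegral.isIntegral α
  have hdeg : (minpoly k α).natDegree = 2 := by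
    rw [← IntermediateField.adjoin.finrank hint, hα, IntermediateField.finrank_top', h2]
  have hirr := minpoly.irreducible hint
  set f := minpoly k α
  have hf : ∀ x, f.eval x = f.coeff 2 * (x * x) + f.coeff 1 * x + f.coeff 0 := by
    intro x
    rw [Polynomial.eval_eq_sum_range, hdeg]
    simp [Finset.sum_range_succ]
    ring
  have hf2 : f.coeff 2 = 1 := by
    have := (minpoly.monic hint).coeff_natDegree
    rwa [show (minpoly k α).natDegree = 2 from hdeg] at this
  obtain ⟨s, hs⟩ := hsq (discrim (f.coeff 2) (f.coeff 1) (f.coeff 0))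
  obtain ⟨x, hx⟩ := exists_quadratic_eq_zero (by rw [hf2]; exact one_ne_zero) ⟨s, hs⟩
  have hroot : f.IsRoot x := by rw [Polynomial.IsRoot, hf, hx]
  have := Polynomial.natDegree_eq_of_degree_eq_some
      (Polynomial.degree_eq_one_of_irreducible_of_root hirr hroot)
  rw [hdeg] at this
  exact absurd this (by norm_num)

/-- The theorem of Artin and Schreier: a finite Galois extension of a real closed field containing a
square root of `-1` is generated by it. -/
theorem exists_eq_add_mul_of_isGalois {F L : Type*} [Field F] [LinearOrder F]
    [IsStrictOrderedRing F] [IsRealClosed F] [Field L] [Algebra F L] [FiniteDimensional F L]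
    [IsGalois F L] {i : L} (hi : i * i = -1) (c : L) :
    ∃ a b : F, c = algebraMap F L a + algebraMap F L b * i := by
  obtain ⟨m, hm⟩ := exists_finrank_eq_two_pow (F := F) (L := L)
  have hk : ∀ x ∈ F⟮i⟯, ∃ a b : F, x = algebraMap F L a + algebraMap F L b * i := by
    intro x hx
    rw [← IntermediateField.mem_toSubalgebra,
      IntermediateField.adjoin_simple_toSubalgebra_of_isAlgebraic
      (Algebra.IsAlgebraic.isAlgebraic i)] at hx
    induction hx using Algebra.adjoin_induction with
    | mem x hx => exact ⟨0, 1, by rw [Set.mem_singleton_iff.mp hx]; simp⟩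
    | algebraMap r => exact ⟨r, 0, by simp⟩
    | add x y _ _ hx hy =>
      obtain ⟨a, b, rfl⟩ := hx
      obtain ⟨a', b', rfl⟩ := hy
      exact ⟨a + a', b + b', by simp only [map_add]; ring⟩
    | mul x y _ _ hx hy =>
      obtain ⟨a, b, rfl⟩ := hx
      obtain ⟨a', b', rfl⟩ := hy
      refine ⟨a * a' - b * b', a * b' + a' * b, ?_⟩
      simp only [map_add, map_mul, map_sub]
      linear_combination (algebraMap F L b * algebraMap F L b') * hi
  have hsq : ∀ x : F⟮i⟯, IsSquare x := by
    rintro ⟨x, hx⟩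
    obtain ⟨a, b, rfl⟩ := hk x hx
    obtain ⟨u, v, hu, hv⟩ := exists_complex_sqrt a b
    refine ⟨⟨algebraMap F L u + algebraMap F L v * i, ?_⟩, ?_⟩
    · exact add_mem (IntermediateField.algebraMap_mem _ _)
        (mul_mem (IntermediateField.algebraMap_mem _ _) (mem_adjoin_simple_self F i))
    · apply Subtype.ext
      simp only [MulMemClass.mk_mul_mk]
      rw [← hu, ← hv]
      simp only [map_mul, map_sub, map_ofNat]
      linear_combination -(algebraMap F L v * algebraMap F L v) * hi
  have hfin : finrank F⟮i⟯ L = 1 := by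
    have hdvd : finrank F⟮i⟯ L ∣ 2 ^ m := by
      rw [← hm, ← finrank_mul_finrank F F⟮i⟯ L]
      exact dvd_mul_left _ _
    obtain ⟨n, -, hn⟩ := (Nat.dvd_prime_pow Nat.prime_two).mp hdvd
    exact finrank_eq_one_of_forall_isSquare hsq hn
  have htop : F⟮i⟯ = ⊤ := by
    rwa [← finrank_eq_one_iff_eq_top]
  exact hk c (htop ▸ mem_top)

/-- A real closed subfield of the reals is relatively algebraically closed. -/
theorem mem_of_isAlgebraic (F : Subfield ℝ) (hF : IsRealClosed F) {c : ℝ}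
    (hc : IsAlgebraic F c) : c ∈ F := by
  have hcC : IsIntegral F (c : ℂ) := hc.isIntegral.map (IsScalarTower.toAlgHom F ℝ ℂ)
  let f : Polynomial F := minpoly F (c : ℂ) * (Polynomial.X ^ 2 + 1)
  have hX : (Polynomial.X ^ 2 + 1 : Polynomial F).Monic := by monicity!
  have hf : f ≠ 0 := mul_ne_zero (minpoly.ne_zero hcC) hX.ne_zero
  let L : IntermediateField F ℂ := adjoin F (f.rootSet ℂ)
  have : f.IsSplittingField F L :=
    IntermediateField.adjoin_rootSet_isSplittingField (IsAlgClosed.splits _)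
  have : FiniteDimensional F L := Polynomial.IsSplittingField.finiteDimensional L f
  have : Normal F L := Normal.of_isSplittingField f
  have : IsGalois F L := ⟨⟩
  let c' : L := ⟨c, subset_adjoin _ _ ((Polynomial.mem_rootSet_of_ne hf).mpr (by simp [f]))⟩
  let i' : L := ⟨Complex.I, subset_adjoin _ _ ((Polynomial.mem_rootSet_of_ne hf).mpr (by simp [f]))⟩
  have hi' : i' * i' = -1 := Subtype.ext Complex.I_mul_I
  obtain ⟨a, b, hab⟩ := exists_eq_add_mul_of_isGalois (F := F) hi' c'
  have h1 : (c : ℂ) = ((a : ℝ) : ℂ) + ((b : ℝ) : ℂ) * Complex.I := congrArg Subtype.val hab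
  have h2 : c = a := by simpa using congrArg Complex.re h1
  rw [h2]
  exact a.2

theorem exists_isRoot_of_odd_natDegree (f : Polynomial ℝ) (hf : Odd f.natDegree) :
    ∃ x, f.IsRoot x := by
  wlog hlc : 0 ≤ f.leadingCoeff generalizing f
  · obtain ⟨x, hx⟩ := this (-f) (by simpa using hf) (by simp at hlc ⊢; exact hlc.le)
    exact ⟨x, by simpa [Polynomial.IsRoot] using hx⟩
  have hdeg : 0 < f.degree := Polynomial.natDegree_pos_iff_degree_pos.mp hf.pos
  have h1 := f.tendsto_atTop_of_leadingCoeff_nonneg hdeg hlc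
  have hd : (f.comp (-Polynomial.X)).natDegree = f.natDegree := by
    simp [Polynomial.natDegree_comp]
  have h2 := (f.comp (-Polynomial.X)).tendsto_atBot_of_leadingCoeff_nonpos
    (by rw [← Polynomial.natDegree_pos_iff_degree_pos, hd]; exact hf.pos)
    (by rw [Polynomial.leadingCoeff_comp (by simp)]; simp [hf.neg_one_pow, hlc])
  obtain ⟨a, ha⟩ := (h1.eventually_ge_atTop 0).exists
  obtain ⟨b, hb⟩ := (h2.eventually_le_atBot 0).exists
  have hb' : f.eval (-b) ≤ 0 := by simpa using hb
  obtain ⟨x, hx⟩ := mem_range_of_exists_le_of_exists_ge f.continuous ⟨_, hb'⟩ ⟨_, ha⟩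
  exact ⟨x, hx⟩

theorem isRealClosed_of_forall_isAlgebraic (K : Subfield ℝ)
    (hK : ∀ c : ℝ, IsAlgebraic K c → c ∈ K) : IsRealClosed K := by
  refine IsRealClosed.of_linearOrderedField ?_ ?_
  · intro x hx
    have hx' : (0 : ℝ) ≤ (x : ℝ) := hx
    have hs : √(x : ℝ) ∈ K := by
      refine hK _ ⟨Polynomial.X ^ 2 - Polynomial.C x,
        Polynomial.X_pow_sub_C_ne_zero (by norm_num) x, ?_⟩
      simp [Real.sq_sqrt hx', Algebra.algebraMap_eq_smul_one, Subfield.smul_def]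
    exact ⟨⟨_, hs⟩, Subtype.ext (Real.mul_self_sqrt hx').symm⟩
  · intro f hf
    have hf0 : f ≠ 0 := by rintro rfl; simp at hf
    obtain ⟨x, hx⟩ := exists_isRoot_of_odd_natDegree (f.map (algebraMap K ℝ)) (by simpa using hf)
    have hxa : Polynomial.aeval x f = 0 := by
      rwa [Polynomial.IsRoot, Polynomial.eval_map_algebraMap] at hx
    refine ⟨⟨x, hK x ⟨f, hf0, hxa⟩⟩, ?_⟩
    apply (algebraMap K ℝ).injective
    rw [← Polynomial.aeval_algebraMap_apply_eq_algebraMap_eval, map_zero]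
    exact hxa

end RealClosed

/-! ### Sign patterns of real polynomials on the line -/

section SignPattern

open Polynomial

/-- An automorphism of the line moving `s` to `t` inside of a given interval and nothing outside. -/
theorem exists_orderIso_bump {a b s t : ℝ} (has : a < s) (hsb : s < b) (hat : a < t) (htb : t < b) :
    ∃ g : ℝ ≃o ℝ, g s = t ∧ (∀ y ≤ a, g y = y) ∧ ∀ y, b ≤ y → g y = y := by
  let f : ℝ → ℝ → ℝ → ℝ := fun s t y =>
    if y ≤ a then y else if y ≤ s then a + (y - a) * ((t - a) / (s - a)) else
      if y ≤ b then b - (b - y) * ((b - t) / (b - s)) else y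
  have f1 : ∀ s t y, y ≤ a → f s t y = y := fun s t y hy => by simp [f, hy]
  have f2 : ∀ s t y, a < y → y ≤ s → f s t y = a + (y - a) * ((t - a) / (s - a)) :=
    fun s t y hy hy' => by simp [f, hy', hy.not_ge]
  have f3 : ∀ s t y, a < s → s < y → y ≤ b → f s t y = b - (b - y) * ((b - t) / (b - s)) :=
    fun s t y hs hy hy' => by simp [f, hy', hy.not_ge, (hs.trans hy).not_ge]
  have f4 : ∀ s t y, a < s → s < b → b < y → f s t y = y :=
    fun s t y hs hs' hy => by
      simp [f, hy.not_ge, (hs'.trans hy).not_ge, (hs.trans (hs'.trans hy)).not_ge]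
  have key : ∀ s t, a < s → s < b → a < t → t < b → ∀ y, f t s (f s t y) = y := by
    intro s t has hsb hat htb y
    have e1 : 0 < s - a := by linarith
    have e2 : 0 < t - a := by linarith
    have e3 : 0 < b - s := by linarith
    have e4 : 0 < b - t := by linarith
    rcases le_or_gt y a with h1 | h1
    · rw [f1 _ _ _ h1, f1 _ _ _ h1]
    rcases le_or_gt y s with h2 | h2
    · rw [f2 s t y h1 h2, f2]
      · field_simp
        ring
      · have : 0 < (y - a) * ((t - a) / (s - a)) := by
          have : 0 < y - a := by linarith
          positivity
        linarith
      · have : (y - a) * ((t - a) / (s - a)) ≤ (s - a) * ((t - a) / (s - a)) := by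
          have : y - a ≤ s - a := by linarith
          gcongr
        rw [mul_div_cancel₀ _ e1.ne'] at this
        linarith
    rcases le_or_gt y b with h3 | h3
    · rw [f3 s t y has h2 h3, f3 _ _ _ hat]
      · field_simp
        ring
      · have : (b - y) * ((b - t) / (b - s)) < (b - s) * ((b - t) / (b - s)) := by
          have : b - y < b - s := by linarith
          gcongr
        rw [mul_div_cancel₀ _ e3.ne'] at this
        linarith
      · have : 0 ≤ (b - y) * ((b - t) / (b - s)) := by
          have : 0 ≤ b - y := by linarith
          positivity
        linarith
    · rw [f4 s t y has hsb h3, f4 t s y hat htb h3]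
  have hmono : StrictMono (f s t) := by
    have e1 : 0 < s - a := by linarith
    have e2 : 0 < t - a := by linarith
    have e3 : 0 < b - s := by linarith
    have e4 : 0 < b - t := by linarith
    have c1 : 0 < (t - a) / (s - a) := by positivity
    have c2 : (s - a) * ((t - a) / (s - a)) = t - a := mul_div_cancel₀ _ e1.ne'
    have c3 : 0 < (b - t) / (b - s) := by positivity
    have c4 : (b - s) * ((b - t) / (b - s)) = b - t := mul_div_cancel₀ _ e3.ne'
    intro x y hxy
    simp only [f]
    generalize (t - a) / (s - a) = c at *
    generalize (b - t) / (b - s) = d at *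
    split_ifs <;> first | linarith | nlinarith
  refine ⟨StrictMono.orderIsoOfRightInverse (f s t) hmono (f t s) (key t s hat htb has hsb),
    ?_, f1 s t, ?_⟩
  · change f s t s = t
    rw [f2 _ _ _ has le_rfl]
    have : s - a ≠ 0 := by linarith
    field_simp
    ring
  · intro y hy
    change f s t y = y
    rcases hy.eq_or_lt with rfl | hy
    · rw [f3 _ _ _ has hsb le_rfl]
      ring
    · exact f4 _ _ _ has hsb hy

/-- Two reals are in the same cell of the line cut by `Z`: they are equal or no point of `Z` lies
between them. -/
def SameCell (Z : Set ℝ) (u v : ℝ) : Prop :=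
  ∀ z ∈ Z, (z < u ↔ z < v) ∧ (u < z ↔ v < z)

namespace SameCell

variable {Z : Set ℝ} {u v w : ℝ}

theorem refl (Z : Set ℝ) (u : ℝ) : SameCell Z u u := fun _ _ => ⟨Iff.rfl, Iff.rfl⟩

theorem symm (h : SameCell Z u v) : SameCell Z v u := fun z hz => ⟨(h z hz).1.symm, (h z hz).2.symm⟩

theorem trans (h : SameCell Z u v) (h' : SameCell Z v w) : SameCell Z u w :=
  fun z hz => ⟨(h z hz).1.trans (h' z hz).1, (h z hz).2.trans (h' z hz).2⟩

theorem eq_of_mem (h : SameCell Z u v) (hu : u ∈ Z) : u = v := by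
  rcases lt_trichotomy u v with h1 | h1 | h1
  · exact absurd ((h u hu).1.mpr h1) (lt_irrefl u)
  · exact h1
  · exact absurd ((h u hu).2.mpr h1) (lt_irrefl u)

theorem mem_iff (h : SameCell Z u v) : u ∈ Z ↔ v ∈ Z :=
  ⟨fun hu => h.eq_of_mem hu ▸ hu, fun hv => h.symm.eq_of_mem hv ▸ hv⟩

theorem of_mem_Icc (h : SameCell Z u v) (hw : w ∈ Set.Icc u v) : SameCell Z w v := by
  intro z hz
  obtain ⟨h1, h2⟩ := h z hz
  refine ⟨⟨fun h3 => h3.trans_le hw.2, fun h3 => (h1.mpr h3).trans_le hw.1⟩,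
    ⟨fun h3 => h2.mp (hw.1.trans_lt h3), fun h3 => hw.2.trans_lt h3⟩⟩

theorem of_mem_uIcc (h : SameCell Z u v) (hw : w ∈ Set.uIcc u v) : SameCell Z w v := by
  rcases le_total u v with huv | huv
  · rw [Set.uIcc_of_le huv] at hw
    exact h.of_mem_Icc hw
  · rw [Set.uIcc_of_ge huv] at hw
    exact (h.symm.of_mem_Icc hw).trans h

theorem map {Z' : Set ℝ} {h : ℝ ≃o ℝ} (hZ : ∀ y, y ∈ Z ↔ h y ∈ Z') (huv : SameCell Z u v) :
    SameCell Z' (h u) (h v) := by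
  intro z hz
  obtain ⟨z, rfl⟩ := h.surjective z
  simpa using huv z ((hZ z).mpr hz)

theorem exists_lt (hZ : Z.Finite) (hu : u ∉ Z) : ∃ a < u, SameCell Z a u := by
  have h1 : ∀ᶠ a in 𝓝[<] u, a ∈ Set.Ioo (u - 1) u := Ioo_mem_nhdsLT (by linarith)
  have h2 : ∀ᶠ a in 𝓝[<] u, ∀ z ∈ Z, z < u → z < a := by
    rw [Filter.eventually_all_finite hZ]
    intro z _
    by_cases hzu : z < u
    · filter_upwards [Ioo_mem_nhdsLT hzu] with a ha _ using ha.1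
    · simp [hzu]
  obtain ⟨a, ha1, ha2⟩ := (h1.and h2).exists
  refine ⟨a, ha1.2, fun z hz => ⟨⟨fun h => h.trans ha1.2, ha2 z hz⟩, fun h => ?_, ha1.2.trans⟩⟩
  rcases lt_trichotomy z u with h3 | rfl | h3
  · exact absurd (ha2 z hz h3) h.not_gt
  · exact absurd hz hu
  · exact h3

theorem neg (h : SameCell Z u v) : SameCell (-Z) (-u) (-v) := by
  intro z hz
  obtain ⟨h1, h2⟩ := h (-z) hz
  exact ⟨by rw [lt_neg, h2, lt_neg], by rw [neg_lt, h1, neg_lt]⟩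

theorem exists_gt (hZ : Z.Finite) (hu : u ∉ Z) : ∃ b > u, SameCell Z b u := by
  obtain ⟨a, ha, h⟩ := exists_lt (u := -u) hZ.neg (by simpa using hu)
  exact ⟨-a, by linarith, by simpa using h.neg⟩

/-- A polynomial has constant sign on the cells cut by its roots. -/
theorem sign_eval_eq {q : ℝ[X]} (hq : ∀ y, q.eval y = 0 → y ∈ Z) (h : SameCell Z u v) :
    SignType.sign (q.eval u) = SignType.sign (q.eval v) := by
  by_contra hne
  have h0 : (0 : ℝ) ∈ Set.uIcc (q.eval u) (q.eval v) := by
    rw [Set.mem_uIcc]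
    rcases lt_trichotomy (q.eval u) 0 with h1 | h1 | h1 <;>
      rcases lt_trichotomy (q.eval v) 0 with h2 | h2 | h2
    all_goals first
      | exact Or.inl ⟨by linarith, by linarith⟩
      | exact Or.inr ⟨by linarith, by linarith⟩
      | exact absurd (by simp [sign_neg, sign_pos, h1, h2]) hne
  obtain ⟨c, hc, hc0⟩ := intermediate_value_uIcc q.continuous.continuousOn h0
  have hcv := h.of_mem_uIcc hc
  have e1 := hcv.eq_of_mem (hq c hc0)
  have e2 := (hcv.trans h.symm).eq_of_mem (hq c hc0)
  exact hne (by rw [← e1, ← e2])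

end SameCell

variable {Z Z' : Set ℝ} {p q : ℝ[X]}

theorem eval_lt_eval_of_derivative_pos (hZ : ∀ y, p.derivative.eval y = 0 → y ∈ Z) {u v : ℝ}
    (huv : u < v) (hfree : ∀ w ∈ Z, w ≤ u ∨ v < w) (hv : 0 < p.derivative.eval v) :
    p.eval u < p.eval v := by
  have : StrictMonoOn (fun x => p.eval x) (Set.Icc u v) := by
    apply strictMonoOn_of_deriv_pos (convex_Icc u v) p.continuous.continuousOn
    intro c hc
    rw [interior_Icc] at hc
    rw [Polynomial.deriv]
    have hs : SameCell Z c v := by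
      intro z hz
      rcases hfree z hz with h | h
      · exact ⟨⟨fun _ => h.trans_lt huv, fun _ => h.trans_lt hc.1⟩,
          ⟨fun h' => absurd h' (not_lt.mpr (h.trans hc.1.le)),
            fun h' => absurd h' (not_lt.mpr (h.trans huv.le))⟩⟩
      · exact ⟨⟨fun h' => absurd h' (not_lt.mpr (hc.2.trans h).le),
          fun h' => absurd h' h.not_gt⟩, ⟨fun _ => h, fun _ => hc.2.trans h⟩⟩
    have := hs.sign_eval_eq hZ
    rw [sign_pos hv] at this
    exact sign_eq_one_iff.mp this
  exact this (Set.left_mem_Icc.mpr huv.le) (Set.right_mem_Icc.mpr huv.le) huv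

theorem SameCell.eval_lt_eval (hZ : ∀ y, p.derivative.eval y = 0 → y ∈ Z) {u v : ℝ}
    (h : SameCell Z u v) (huv : u < v) (hv : 0 < p.derivative.eval v) : p.eval u < p.eval v := by
  refine eval_lt_eval_of_derivative_pos hZ huv (fun w hw => ?_) hv
  rcases le_or_gt w u with h1 | h1
  · exact Or.inl h1
  · exact Or.inr ((h w hw).2.mp h1)

theorem SameCell.eq_of_eval_eq (hZ : ∀ y, p.derivative.eval y = 0 → y ∈ Z) {u v : ℝ}
    (h : SameCell Z u v) (he : p.eval u = p.eval v) : u = v := by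
  wlog huv : u < v generalizing u v
  · rcases eq_or_lt_of_not_gt huv with h' | h'
    · exact h'.symm ▸ rfl
    · exact (this h.symm he.symm h').symm
  exfalso
  have hv : v ∉ Z := fun hv => huv.ne (h.symm.eq_of_mem hv).symm
  have hv0 : p.derivative.eval v ≠ 0 := fun h0 => hv (hZ v h0)
  rcases hv0.lt_or_gt with h1 | h1
  · have := SameCell.eval_lt_eval (p := -p) (Z := Z) (by simpa using hZ) h huv (by simpa using h1)
    simp only [eval_neg] at this
    linarith
  · exact (h.eval_lt_eval hZ huv h1).ne he

/-- If `p` takes a value `≤ 0` in a cell where it increases, then it is negative at the left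
endpoint of the cell. -/
theorem eval_neg_of_left_endpoint (hZ : ∀ y, p.derivative.eval y = 0 → y ∈ Z) {u y z : ℝ}
    (hy : y ∉ Z) (hpy : 0 < p.derivative.eval y) (hu : SameCell Z u y) (hpu : p.eval u ≤ 0)
    (hz : z ∈ Z) (hzy : z < y) (hcons : ∀ w ∈ Z, w ≤ z ∨ y ≤ w) : p.eval z < 0 := by
  have hpu' : 0 < p.derivative.eval u := by
    have := hu.sign_eval_eq hZ
    rw [sign_pos hpy] at this
    exact sign_eq_one_iff.mp this
  refine (eval_lt_eval_of_derivative_pos hZ ((hu z hz).1.mpr hzy) (fun w hw => ?_) hpu').trans_le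
    hpu
  rcases hcons w hw with h1 | h1
  · exact Or.inl h1
  · refine Or.inr ((hu w hw).2.mpr (lt_of_le_of_ne h1 ?_))
    rintro rfl
    exact hy hw

/-- If `p` is negative at the left endpoint of a cell where it increases, or there is no such
endpoint, then it takes a negative value in that cell. -/
theorem exists_sameCell_eval_neg (hfin : Z.Finite) (hZ : ∀ y, p.derivative.eval y = 0 → y ∈ Z)
    {y : ℝ} (hy : y ∉ Z) (hpy : 0 < p.derivative.eval y)
    (hend : ∀ z ∈ Z, z < y → (∀ w ∈ Z, w ≤ z ∨ y ≤ w) → p.eval z < 0) :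
    ∃ u, SameCell Z u y ∧ p.eval u < 0 := by
  rcases (Z ∩ Set.Iio y).eq_empty_or_nonempty with hem | hne
  · by_contra hcon
    push Not at hcon
    have hno : ∀ z ∈ Z, y < z := by
      intro z hz
      rcases lt_trichotomy z y with h | rfl | h
      · exact absurd (show z ∈ Z ∩ Set.Iio y from ⟨hz, h⟩) (by rw [hem]; exact id)
      · exact absurd hz hy
      · exact h
    have hcell : ∀ u ≤ y, SameCell Z u y := fun u hu z hz =>
      ⟨⟨fun h => absurd (h.trans_le hu) (hno z hz).not_gt, fun h => absurd h (hno z hz).not_gt⟩,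
        ⟨fun _ => hno z hz, fun h => hu.trans_lt h⟩⟩
    have hdeg : 0 < (p.comp (-X)).degree := by
      rw [← natDegree_pos_iff_degree_pos, natDegree_comp, natDegree_neg, natDegree_X, mul_one]
      by_contra h0
      rw [Polynomial.eq_C_of_natDegree_eq_zero (Nat.eq_zero_of_not_pos h0)] at hpy
      simp at hpy
    have hlim := Polynomial.abs_tendsto_atTop (p.comp (-X)) hdeg
    obtain ⟨t, ht1, ht2⟩ := ((hlim.eventually_gt_atTop (p.eval y)).and
      (Filter.eventually_ge_atTop (-y))).exists
    have e : (p.comp (-X)).eval t = p.eval (-t) := by simp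
    rw [e, abs_of_nonneg (hcon _ (hcell (-t) (by linarith)))] at ht1
    rcases (show -t ≤ y by linarith).eq_or_lt with h1 | h1
    · rw [h1] at ht1
      exact lt_irrefl _ ht1
    · exact lt_asymm ht1 ((hcell (-t) h1.le).eval_lt_eval hZ h1 hpy)
  · obtain ⟨z, ⟨hz, hzy⟩, hmax⟩ := (hfin.inter_of_left (Set.Iio y)).exists_maximal hne
    have hcons : ∀ w ∈ Z, w < y → w ≤ z := fun w hw hwy => by
      by_contra hlt
      exact hlt (hmax ⟨hw, hwy⟩ (not_le.mp hlt).le)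
    have hpz := hend z hz hzy fun w hw => by
      rcases lt_or_ge w y with h | h
      · exact Or.inl (hcons w hw h)
      · exact Or.inr h
    have h1 : ∀ᶠ u in 𝓝[>] z, p.eval u < 0 :=
      nhdsWithin_le_nhds (p.continuous.continuousAt.eventually_lt continuousAt_const hpz)
    obtain ⟨u, hu1, hu2⟩ := (h1.and (Ioo_mem_nhdsGT hzy)).exists
    refine ⟨u, fun w hw => ⟨⟨fun h => h.trans hu2.2, fun h => (hcons w hw h).trans_lt hu2.1⟩,
      ⟨fun h => ?_, fun h => hu2.2.trans h⟩⟩, hu1⟩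
    rcases lt_trichotomy w y with h3 | rfl | h3
    · exact absurd ((hcons w hw h3).trans_lt hu2.1) h.not_gt
    · exact absurd hw hy
    · exact h3

/-- The automorphism `h` of the line respects the cuts `Z`, `Z'`, the signs of the derivatives of
`p` and `q`, and the signs of `p` and `q` at the cuts. -/
structure CutCompatible (Z Z' : Set ℝ) (p q : ℝ[X]) (h : ℝ ≃o ℝ) : Prop where
  mem_iff : ∀ y, y ∈ Z ↔ h y ∈ Z'
  sign_derivative : ∀ y, SignType.sign (p.derivative.eval y) =
    SignType.sign (q.derivative.eval (h y))
  sign_eval : ∀ y ∈ Z, SignType.sign (p.eval y) = SignType.sign (q.eval (h y))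
  finite_left : Z.Finite
  finite_right : Z'.Finite
  root_left : ∀ y, p.derivative.eval y = 0 → y ∈ Z
  root_right : ∀ y, q.derivative.eval y = 0 → y ∈ Z'

namespace CutCompatible

variable {h : ℝ ≃o ℝ}

theorem symm (H : CutCompatible Z Z' p q h) : CutCompatible Z' Z q p h.symm where
  mem_iff y := by rw [H.mem_iff, h.apply_symm_apply]
  sign_derivative y := by rw [H.sign_derivative, h.apply_symm_apply]
  sign_eval y hy := by
    rw [H.sign_eval _ ((H.mem_iff _).mpr (by rwa [h.apply_symm_apply])), h.apply_symm_apply]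
  finite_left := H.finite_right
  finite_right := H.finite_left
  root_left := H.root_right
  root_right := H.root_left

theorem neg (H : CutCompatible Z Z' p q h) : CutCompatible Z Z' (-p) (-q) h where
  mem_iff := H.mem_iff
  sign_derivative y := by simp [Left.sign_neg, H.sign_derivative y]
  sign_eval y hy := by simp [Left.sign_neg, H.sign_eval y hy]
  finite_left := H.finite_left
  finite_right := H.finite_right
  root_left := by simpa using H.root_left
  root_right := by simpa using H.root_right

/-- The automorphism `h` conjugated by the reflection of the line. -/
def reflect (h : ℝ ≃o ℝ) : ℝ ≃o ℝ :=
  ((OrderIso.neg ℝ).trans h.dual).trans (OrderIso.neg ℝ).symm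

theorem reflect_apply (h : ℝ ≃o ℝ) (y : ℝ) : reflect h y = -h (-y) := rfl

theorem comp_neg (H : CutCompatible Z Z' p q h) :
    CutCompatible (-Z) (-Z') (p.comp (-X)) (q.comp (-X)) (reflect h) where
  mem_iff y := by simpa [reflect_apply] using H.mem_iff (-y)
  sign_derivative y := by
    simpa [reflect_apply, derivative_comp, Left.sign_neg] using H.sign_derivative (-y)
  sign_eval y hy := by simpa [reflect_apply] using H.sign_eval (-y) hy
  finite_left := H.finite_left.neg
  finite_right := H.finite_right.neg
  root_left y hy := H.root_left (-y) (by simpa [derivative_comp] using hy)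
  root_right y hy := H.root_right (-y) (by simpa [derivative_comp] using hy)

theorem of_sameCell (H : CutCompatible Z Z' p q h) {g : ℝ ≃o ℝ}
    (hg : ∀ y, SameCell Z' (g y) (h y)) : CutCompatible Z Z' p q g where
  mem_iff y := by rw [H.mem_iff, (hg y).mem_iff]
  sign_derivative y := by rw [H.sign_derivative, (hg y).sign_eval_eq H.root_right]
  sign_eval y hy := by rw [H.sign_eval y hy, (hg y).symm.eq_of_mem ((H.mem_iff y).mp hy)]
  finite_left := H.finite_left
  finite_right := H.finite_right
  root_left := H.root_left
  root_right := H.root_right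

theorem exists_eval_neg_of_derivative_pos (H : CutCompatible Z Z' p q h) {u y : ℝ} (hy : y ∉ Z)
    (hpy : 0 < p.derivative.eval y) (hu : SameCell Z u y) (hpu : p.eval u ≤ 0) :
    ∃ v, SameCell Z' v (h y) ∧ q.eval v < 0 := by
  have hqy : 0 < q.derivative.eval (h y) := by
    have := H.sign_derivative y
    rw [sign_pos hpy] at this
    exact sign_eq_one_iff.mp this.symm
  refine exists_sameCell_eval_neg H.finite_right H.root_right (mt (H.mem_iff y).mpr hy) hqy ?_
  intro z hz hzy hcons
  obtain ⟨z, rfl⟩ := h.surjective z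
  have hz' := (H.mem_iff z).mpr hz
  have := eval_neg_of_left_endpoint H.root_left hy hpy hu hpu hz' (by simpa using hzy)
    (fun w hw => by simpa using hcons (h w) ((H.mem_iff w).mp hw))
  have h2 := H.sign_eval z hz'
  rw [sign_neg this] at h2
  exact sign_eq_neg_one_iff.mp h2.symm

theorem exists_eval_neg (H : CutCompatible Z Z' p q h) {u y : ℝ} (hy : y ∉ Z)
    (hu : SameCell Z u y) (hpu : p.eval u ≤ 0) :
    ∃ v, SameCell Z' v (h y) ∧ q.eval v < 0 := by
  rcases lt_trichotomy (p.derivative.eval y) 0 with h0 | h0 | h0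
  · obtain ⟨v, hv, hqv⟩ := H.comp_neg.exists_eval_neg_of_derivative_pos (u := -u) (y := -y)
      (by simpa using hy) (by simpa [derivative_comp] using h0) hu.neg (by simpa using hpu)
    exact ⟨-v, by simpa [reflect_apply] using hv.neg, by simpa using hqv⟩
  · exact absurd (H.root_left y h0) hy
  · exact H.exists_eval_neg_of_derivative_pos hy h0 hu hpu

theorem exists_eval_pos (H : CutCompatible Z Z' p q h) {u y : ℝ} (hy : y ∉ Z)
    (hu : SameCell Z u y) (hpu : 0 ≤ p.eval u) :
    ∃ v, SameCell Z' v (h y) ∧ 0 < q.eval v := by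
  simpa using H.neg.exists_eval_neg hy hu (by simpa using hpu)

theorem exists_root (H : CutCompatible Z Z' p q h) {y : ℝ} (hy : y ∉ Z) (hp : p.eval y = 0) :
    ∃ v, SameCell Z' v (h y) ∧ q.eval v = 0 := by
  obtain ⟨v, hv, hqv⟩ := H.exists_eval_neg hy (.refl _ _) hp.le
  obtain ⟨w, hw, hqw⟩ := H.exists_eval_pos hy (.refl _ _) hp.ge
  obtain ⟨c, hc, hc0⟩ := intermediate_value_uIcc q.continuous.continuousOn
    (Set.mem_uIcc.mpr (Or.inl ⟨hqv.le, hqw.le⟩))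
  exact ⟨c, ((hv.trans hw.symm).of_mem_uIcc hc).trans hw, hc0⟩

/-- The automorphism can be changed inside of the cells so that it moves any finite set of roots of
`p` to roots of `q`. -/
theorem exists_map_roots (H : CutCompatible Z Z' p q h) (R : Finset ℝ)
    (hR : ∀ r ∈ R, p.eval r = 0) :
    ∃ g : ℝ ≃o ℝ, (∀ y, SameCell Z' (g y) (h y)) ∧ ∀ r ∈ R, q.eval (g r) = 0 := by
  classical
  induction R using Finset.induction_on with
  | empty => exact ⟨h, fun y => .refl _ _, by simp⟩
  | insert r R hrR ih =>
    obtain ⟨g, hg, hgR⟩ := ih fun r hr => hR r (Finset.mem_insert_of_mem hr)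
    have hpr := hR r (Finset.mem_insert_self _ _)
    by_cases hqr : q.eval (g r) = 0
    · refine ⟨g, hg, fun s hs => ?_⟩
      rcases Finset.mem_insert.mp hs with rfl | hs
      exacts [hqr, hgR s hs]
    have G := H.of_sameCell hg
    have hrZ : r ∉ Z := fun hr => hqr (by
      have := G.sign_eval r hr
      rw [hpr, sign_zero] at this
      exact sign_eq_zero_iff.mp this.symm)
    obtain ⟨t, ht, hqt⟩ := G.exists_root hrZ hpr
    have hgr : g r ∉ Z' := mt (G.mem_iff r).mpr hrZ
    have htZ : t ∉ Z' := mt ht.mem_iff.mp hgr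
    obtain ⟨a, ha, hac⟩ : ∃ a, (a < g r ∧ a < t) ∧ SameCell Z' a (g r) := by
      rcases le_total (g r) t with hle | hle
      · obtain ⟨a, ha, hc⟩ := SameCell.exists_lt G.finite_right hgr
        exact ⟨a, ⟨ha, ha.trans_le hle⟩, hc⟩
      · obtain ⟨a, ha, hc⟩ := SameCell.exists_lt G.finite_right htZ
        exact ⟨a, ⟨ha.trans_le hle, ha⟩, hc.trans ht⟩
    obtain ⟨b, hb, hbc⟩ : ∃ b, (g r < b ∧ t < b) ∧ SameCell Z' b (g r) := by
      rcases le_total (g r) t with hle | hle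
      · obtain ⟨b, hb, hc⟩ := SameCell.exists_gt G.finite_right htZ
        exact ⟨b, ⟨hle.trans_lt hb, hb⟩, hc.trans ht⟩
      · obtain ⟨b, hb, hc⟩ := SameCell.exists_gt G.finite_right hgr
        exact ⟨b, ⟨hb, hle.trans_lt hb⟩, hc⟩
    obtain ⟨f, hf, hfa, hfb⟩ := exists_orderIso_bump ha.1 hb.1 ha.2 hb.2
    have hab : SameCell Z' a b := hac.trans hbc.symm
    have hfc : ∀ w, SameCell Z' (f w) w := by
      intro w
      rcases le_or_gt w a with h1 | h1
      · rw [hfa w h1]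
        exact .refl _ _
      rcases le_or_gt b w with h2 | h2
      · rw [hfb w h2]
        exact .refl _ _
      have h3 : a < f w := by
        rw [← hfa a le_rfl]
        exact f.strictMono h1
      have h4 : f w < b := by
        rw [← hfb b le_rfl]
        exact f.strictMono h2
      exact (hab.of_mem_Icc ⟨h3.le, h4.le⟩).trans (hab.of_mem_Icc ⟨h1.le, h2.le⟩).symm
    refine ⟨g.trans f, fun y => (hfc (g y)).trans (hg y), fun s hs => ?_⟩
    rcases Finset.mem_insert.mp hs with rfl | hsR
    · simpa [hf] using hqt
    have hsr : s ≠ r := by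
      rintro rfl
      exact hrR hsR
    have hfix : f (g s) = g s := by
      rcases le_or_gt (g s) a with h1 | h1
      · exact hfa _ h1
      rcases le_or_gt b (g s) with h2 | h2
      · exact hfb _ h2
      exfalso
      have h3 : SameCell Z' (g s) (g r) := (hab.of_mem_Icc ⟨h1.le, h2.le⟩).trans hbc
      have h4 : SameCell Z s r := by simpa using h3.map G.symm.mem_iff
      exact hsr (h4.eq_of_eval_eq G.root_left
        (by rw [hpr, hR s (Finset.mem_insert_of_mem hsR)]))
    change q.eval (f (g s)) = 0
    rw [hfix, hgR s hsR]

theorem eval_neg_of_map_roots (H : CutCompatible Z Z' p q h)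
    (hroots : ∀ r, p.eval r = 0 → q.eval (h r) = 0) {y : ℝ} (hy : y ∉ Z) (hpy : p.eval y < 0) :
    q.eval (h y) < 0 := by
  by_contra hcon
  push Not at hcon
  have hhy : h y ∉ Z' := mt (H.mem_iff y).mpr hy
  obtain ⟨v, hv, hqv⟩ := H.exists_eval_neg hy (.refl _ _) hpy.le
  obtain ⟨c, hc, hc0⟩ := intermediate_value_uIcc q.continuous.continuousOn
    (Set.mem_uIcc.mpr (Or.inl ⟨hqv.le, hcon⟩))
  have hcy := hv.of_mem_uIcc hc
  obtain ⟨r, hr, hr0⟩ := H.symm.exists_root (mt hcy.mem_iff.mp hhy) hc0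
  have hry : SameCell Z r y := by simpa using hr.trans (hcy.map H.symm.mem_iff)
  have hrc : SameCell Z' (h r) (h y) := hry.map H.mem_iff
  have hry0 : r ≠ y := by
    rintro rfl
    exact hpy.ne hr0
  have hsgn := H.sign_derivative y
  have hsr := hry.sign_eval_eq H.root_left
  have hsr' := hrc.sign_eval_eq H.root_right
  have key : ∀ (f : ℝ[X]) (W : Set ℝ) (u v : ℝ), (∀ y, f.derivative.eval y = 0 → y ∈ W) →
      SameCell W u v → u < v → f.derivative.eval v < 0 → f.eval v < f.eval u := by
    intro f W u v hf huv hlt hneg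
    have := huv.eval_lt_eval (p := -f) (by simpa using hf) hlt (by simpa using hneg)
    simpa using this
  have hq0 := hroots r hr0
  rcases lt_trichotomy (p.derivative.eval y) 0 with h0 | h0 | h0
  · have hq : q.derivative.eval (h y) < 0 := by
      rw [sign_neg h0] at hsgn
      exact sign_eq_neg_one_iff.mp hsgn.symm
    rcases lt_or_gt_of_ne hry0 with h1 | h1
    · have := key q Z' (h r) (h y) H.root_right hrc (h.strictMono h1) hq
      linarith
    · rw [sign_neg h0] at hsr
      have := key p Z y r H.root_left hry.symm h1 (sign_eq_neg_one_iff.mp hsr)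
      linarith
  · exact hy (H.root_left y h0)
  · have hq : 0 < q.derivative.eval (h y) := by
      rw [sign_pos h0] at hsgn
      exact sign_eq_one_iff.mp hsgn.symm
    rcases lt_or_gt_of_ne hry0 with h1 | h1
    · have := hry.eval_lt_eval H.root_left h1 h0
      linarith
    · rw [sign_pos hq] at hsr'
      have := hrc.symm.eval_lt_eval H.root_right (h.strictMono h1) (sign_eq_one_iff.mp hsr')
      linarith

/-- The automorphism can be changed inside of the cells so that it respects the signs of `p` and
`q`. -/
theorem exists_sign_eq (H : CutCompatible Z Z' p q h) :
    ∃ g : ℝ ≃o ℝ, (∀ y, SameCell Z' (g y) (h y)) ∧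
      ∀ y, SignType.sign (p.eval y) = SignType.sign (q.eval (g y)) := by
  have hp0 : p ≠ 0 := by
    rintro rfl
    exact Set.infinite_univ (H.finite_left.subset fun y _ => H.root_left y (by simp))
  obtain ⟨g, hg, hgR⟩ := H.exists_map_roots p.roots.toFinset fun r hr => by
    simpa [hp0] using hr
  have G := H.of_sameCell hg
  have hroots : ∀ r, p.eval r = 0 → q.eval (g r) = 0 := fun r hr => hgR r (by simpa [hp0] using hr)
  refine ⟨g, hg, fun y => ?_⟩
  by_cases hy : y ∈ Z
  · exact G.sign_eval y hy
  rcases lt_trichotomy (p.eval y) 0 with h0 | h0 | h0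
  · rw [sign_neg h0, sign_neg (G.eval_neg_of_map_roots hroots hy h0)]
  · rw [h0, hroots y h0]
  · have := G.neg.eval_neg_of_map_roots (by simpa using hroots) hy (by simpa using h0)
    rw [sign_pos h0, sign_pos (by simpa using this)]

end CutCompatible

end SignPattern

/-! ### Elimination of one variable -/

section Elimination

open Polynomial

variable {B : Type*} [CommRing B]

/-- The signs of the values of the polynomials in `S` along the line, for coefficients specialized
by a ring homomorphism `B → ℝ`, are determined up to an automorphism of the line by the signs of
finitely many elements of `B`. -/
def SignsEliminable (S : Finset B[X]) : Prop :=
  ∃ Q : Finset B, ∀ v w : B →+* ℝ, (∀ b ∈ Q, SignType.sign (v b) = SignType.sign (w b)) →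
    ∃ h : ℝ ≃o ℝ, ∀ p ∈ S, ∀ y,
      SignType.sign ((p.map v).eval y) = SignType.sign ((p.map w).eval (h y))

theorem SignsEliminable.mono {S T : Finset B[X]} (hT : SignsEliminable T) (hST : S ⊆ T) :
    SignsEliminable S := by
  obtain ⟨Q, hQ⟩ := hT
  refine ⟨Q, fun v w hvw => ?_⟩
  obtain ⟨h, hh⟩ := hQ v w hvw
  exact ⟨h, fun p hp => hh p (hST hp)⟩

/-- The part of `q` of degree at most `k`. -/
noncomputable def lowPart (q : B[X]) (k : ℕ) : B[X] :=
  ∑ i ∈ Finset.range (k + 1), monomial i (q.coeff i)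

theorem coeff_lowPart (q : B[X]) (k j : ℕ) :
    (lowPart q k).coeff j = if j ≤ k then q.coeff j else 0 := by
  simp only [lowPart, finsetSum_coeff, coeff_monomial]
  simp [Finset.sum_ite_eq']

theorem map_lowPart_natDegree (q : B[X]) (v w : B →+* ℝ)
    (hvw : ∀ i, v (q.coeff i) = 0 ↔ w (q.coeff i) = 0) :
    (lowPart q (q.map v).natDegree).map w = q.map w := by
  ext j
  rw [coeff_map, coeff_lowPart, coeff_map]
  split_ifs with h
  · rfl
  · rw [map_zero, eq_comm, ← hvw, ← coeff_map]
    exact coeff_eq_zero_of_natDegree_lt (not_le.mp h)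

/-- The combination of `p`, of degree at most `n`, and the part of degree `k` of `q` that cancels
the terms of degree `n`. -/
noncomputable def cancelLead (p q : B[X]) (n k : ℕ) : B[X] :=
  C (q.coeff k) * p - C (p.coeff n) * (X ^ (n - k) * lowPart q k)

theorem natDegree_cancelLead_le {p q : B[X]} {n k : ℕ} (hp : p.natDegree ≤ n + 1)
    (hk : k ≤ n + 1) : (cancelLead p q (n + 1) k).natDegree ≤ n := by
  rw [natDegree_le_iff_coeff_eq_zero]
  intro N hN
  obtain ⟨m, rfl⟩ := Nat.exists_eq_add_of_lt hN
  have hcoeff : (X ^ (n + 1 - k) * lowPart q k).coeff (n + m + 1) =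
      (lowPart q k).coeff (m + k) := by
    rw [show n + m + 1 = (m + k) + (n + 1 - k) by omega, coeff_X_pow_mul]
  rw [cancelLead, coeff_sub, coeff_C_mul, coeff_C_mul, hcoeff, coeff_lowPart]
  rcases Nat.eq_zero_or_pos m with rfl | hm
  · simp [mul_comm]
  · rw [if_neg (by omega), (coeff_eq_zero_of_natDegree_lt (by omega) : p.coeff (n + m + 1) = 0)]
    simp

theorem sign_eval_of_cancelLead {p q : B[X]} {n : ℕ} {v w : B →+* ℝ}
    (hvw : ∀ i, SignType.sign (v (q.coeff i)) = SignType.sign (w (q.coeff i)))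
    (hq : q.map v ≠ 0) {y y' : ℝ} (hy : (q.map v).eval y = 0) (hy' : (q.map w).eval y' = 0)
    (hr : SignType.sign (((cancelLead p q n (q.map v).natDegree).map v).eval y) =
      SignType.sign (((cancelLead p q n (q.map v).natDegree).map w).eval y')) :
    SignType.sign ((p.map v).eval y) = SignType.sign ((p.map w).eval y') := by
  have hvw0 : ∀ i, v (q.coeff i) = 0 ↔ w (q.coeff i) = 0 := fun i => by
    rw [← sign_eq_zero_iff, hvw i, sign_eq_zero_iff]
  have e1 : ((cancelLead p q n (q.map v).natDegree).map v).eval y =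
      v (q.coeff (q.map v).natDegree) * (p.map v).eval y := by
    simp [cancelLead, map_lowPart_natDegree q v v (fun _ => Iff.rfl), hy]
  have e2 : ((cancelLead p q n (q.map v).natDegree).map w).eval y' =
      w (q.coeff (q.map v).natDegree) * (p.map w).eval y' := by
    simp [cancelLead, map_lowPart_natDegree q v w hvw0, hy']
  rw [e1, e2, sign_mul, sign_mul, ← hvw] at hr
  have hne : SignType.sign (v (q.coeff (q.map v).natDegree)) ≠ 0 := by
    rw [Ne, sign_eq_zero_iff, ← coeff_map]
    exact leadingCoeff_ne_zero.mpr hq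
  exact mul_left_cancel₀ hne hr

theorem signsEliminable_insert [DecidableEq B[X]] {S : Finset B[X]} {p : B[X]} {n : ℕ}
    (hp : p.natDegree = n + 1)
    (hS : ∀ q ∈ S, q.natDegree ≤ n + 1)
    (h1 : SignsEliminable (insert p.eraseLead S))
    (h2 : SignsEliminable (S ∪ ({derivative p} ∪ (insert (derivative p) S).biUnion fun q =>
      (Finset.range (n + 2)).image fun k => cancelLead p q (n + 1) k))) :
    SignsEliminable (insert p S) := by
  classical
  obtain ⟨Q1, hQ1⟩ := h1
  obtain ⟨Q2, hQ2⟩ := h2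
  set S' := insert (derivative p) S with hS'
  have hdeg : ∀ q ∈ S', q.natDegree ≤ n + 1 := by
    intro q hq
    rcases Finset.mem_insert.mp hq with rfl | hq
    · exact (natDegree_derivative_le p).trans (by omega)
    · exact hS q hq
  refine ⟨Q1 ∪ (Q2 ∪ (insert (p.coeff (n + 1))
    (S'.biUnion fun q => (Finset.range (n + 2)).image q.coeff))), fun v w hvw => ?_⟩
  obtain ⟨hvw1, hvw2, hlc, hco⟩ : (∀ b ∈ Q1, SignType.sign (v b) = SignType.sign (w b)) ∧
      (∀ b ∈ Q2, SignType.sign (v b) = SignType.sign (w b)) ∧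
      SignType.sign (v (p.coeff (n + 1))) = SignType.sign (w (p.coeff (n + 1))) ∧
      ∀ q ∈ S', ∀ i, SignType.sign (v (q.coeff i)) = SignType.sign (w (q.coeff i)) := by
    refine ⟨fun b hb => hvw b (by simp [hb]), fun b hb => hvw b (by simp [hb]),
      hvw _ (by simp), fun q hq i => ?_⟩
    by_cases hi : i ≤ n + 1
    · refine hvw _ (Finset.mem_union_right _ (Finset.mem_union_right _
        (Finset.mem_insert_of_mem (Finset.mem_biUnion.mpr ⟨q, hq, ?_⟩))))
      exact Finset.mem_image_of_mem _ (Finset.mem_range.mpr (by omega))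
    · rw [coeff_eq_zero_of_natDegree_lt ((hdeg q hq).trans_lt (not_le.mp hi)), map_zero v,
        map_zero w]
  by_cases hv0 : v (p.coeff (n + 1)) = 0
  · have hw0 : w (p.coeff (n + 1)) = 0 := by
      rwa [← sign_eq_zero_iff, ← hlc, sign_eq_zero_iff]
    obtain ⟨h, hh⟩ := hQ1 v w hvw1
    have herase : ∀ u : B →+* ℝ, u (p.coeff (n + 1)) = 0 → p.eraseLead.map u = p.map u := by
      intro u hu
      rw [← self_sub_C_mul_X_pow, leadingCoeff, hp]
      simp [hu]
    refine ⟨h, fun q hq y => ?_⟩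
    rcases Finset.mem_insert.mp hq with rfl | hq
    · rw [← herase v hv0, ← herase w hw0]
      exact hh _ (Finset.mem_insert_self _ _) y
    · exact hh q (Finset.mem_insert_of_mem hq) y
  obtain ⟨h, hh⟩ := hQ2 v w hvw2
  have hh' : ∀ q ∈ S', ∀ y,
      SignType.sign ((q.map v).eval y) = SignType.sign ((q.map w).eval (h y)) := by
    intro q hq
    rcases Finset.mem_insert.mp hq with rfl | hq
    · exact hh _ (by simp)
    · exact hh q (by simp [hq])
  have hco0 : ∀ q ∈ S', (q.map v = 0 ↔ q.map w = 0) := by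
    intro q hq
    simp only [Polynomial.ext_iff, coeff_map, coeff_zero]
    exact forall_congr' fun i => by rw [← sign_eq_zero_iff, hco q hq i, sign_eq_zero_iff]
  -- the cuts are the roots of those specialized polynomials which do not vanish identically
  let cuts : (B →+* ℝ) → Set ℝ := fun u => {y | ∃ q ∈ S', q.map u ≠ 0 ∧ (q.map u).eval y = 0}
  have hfin : ∀ u, (cuts u).Finite := by
    intro u
    refine (S'.finite_toSet.biUnion fun q _ => (q.map u).roots.toFinset.finite_toSet).subset ?_
    rintro y ⟨q, hq, hq0, hy⟩
    exact Set.mem_biUnion hq (by simpa [hq0] using hy)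
  have hder : (derivative p).map v ≠ 0 := by
    intro h0
    have h1 := congrArg (fun f => f.coeff n) h0
    simp only [coeff_map, coeff_derivative, map_mul, map_add, map_natCast, map_one,
      coeff_zero] at h1
    rcases mul_eq_zero.mp h1 with h2 | h2
    · exact hv0 h2
    · exact absurd h2 (by positivity)
  have hder' : (derivative p).map w ≠ 0 := mt (hco0 _ (Finset.mem_insert_self _ _)).mpr hder
  have H : CutCompatible (cuts v) (cuts w) (p.map v) (p.map w) h := by
    refine ⟨fun y => ?_, fun y => ?_, ?_, hfin v, hfin w, fun y hy => ?_, fun y hy => ?_⟩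
    · refine exists_congr fun q => and_congr_right fun hq => and_congr ?_ ?_
      · exact not_congr (hco0 q hq)
      · rw [← sign_eq_zero_iff, hh' q hq, sign_eq_zero_iff]
    · rw [derivative_map, derivative_map]
      exact hh' _ (Finset.mem_insert_self _ _) y
    · rintro y ⟨q, hq, hq0, hy⟩
      have hy' : (q.map w).eval (h y) = 0 := by
        rwa [← sign_eq_zero_iff, ← hh' q hq, sign_eq_zero_iff]
      refine sign_eval_of_cancelLead (n := n + 1) (hco q hq) hq0 hy hy' (hh _ ?_ y)
      refine Finset.mem_union_right _ (Finset.mem_union_right _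
        (Finset.mem_biUnion.mpr ⟨q, hq, Finset.mem_image_of_mem _ (Finset.mem_range.mpr ?_)⟩))
      have := (natDegree_map_le (f := v) (p := q)).trans (hdeg q hq)
      omega
    · rw [derivative_map] at hy
      exact ⟨_, Finset.mem_insert_self _ _, hder, hy⟩
    · rw [derivative_map] at hy
      exact ⟨_, Finset.mem_insert_self _ _, hder', hy⟩
  obtain ⟨g, hg, hgp⟩ := H.exists_sign_eq
  refine ⟨g, fun q hq y => ?_⟩
  rcases Finset.mem_insert.mp hq with rfl | hq
  · exact hgp y
  have hqS := Finset.mem_insert_of_mem (b := derivative p) hq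
  rw [hh' q hqS y]
  by_cases hq0 : q.map w = 0
  · simp [hq0]
  · have hcuts : ∀ z, (q.map w).eval z = 0 → z ∈ cuts w := fun z hz => ⟨q, hqS, hq0, hz⟩
    exact (hg y).symm.sign_eval_eq hcuts

/-- The elimination step of the theorem of Tarski and Seidenberg. The proof follows Muchnik: the
signs of a polynomial of maximal degree are recovered from those of its derivative and of its remainders
modulo the other polynomials. -/
theorem signsEliminable (S : Finset B[X]) : SignsEliminable S := by
  classical
  suffices H : ∀ n, ∀ S : Finset B[X], (∀ p ∈ S, p.natDegree ≤ n) → SignsEliminable S from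
    H (S.sup natDegree) S fun p hp => Finset.le_sup (f := natDegree) hp
  intro n
  induction n with
  | zero =>
    intro S hS
    refine ⟨S.image fun p => p.coeff 0, fun v w hvw => ⟨OrderIso.refl ℝ, fun p hp y => ?_⟩⟩
    rw [eq_C_of_natDegree_eq_zero (Nat.le_zero.mp (hS p hp))]
    simpa using hvw _ (Finset.mem_image_of_mem _ hp)
  | succ n ih =>
    suffices H : ∀ T S : Finset B[X], (∀ p ∈ T, p.natDegree ≤ n + 1) → (∀ p ∈ S, p.natDegree ≤ n) →
        SignsEliminable (S ∪ T) from fun S hS => by simpa using H S ∅ hS (by simp)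
    intro T
    induction T using Finset.induction_on with
    | empty => intro S _ hS; simpa using ih S hS
    | insert p T _ ihT =>
      intro S hT hS
      have hT' : ∀ q ∈ T, q.natDegree ≤ n + 1 := fun q hq => hT q (Finset.mem_insert_of_mem hq)
      have hpn := hT p (Finset.mem_insert_self _ _)
      rcases hpn.lt_or_eq with hlt | heq
      · refine (ihT (insert p S) hT' fun q hq => ?_).mono ?_
        · rcases Finset.mem_insert.mp hq with rfl | hq
          exacts [Nat.lt_succ_iff.mp hlt, hS q hq]
        · intro q
          simp only [Finset.mem_union, Finset.mem_insert]
          tauto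
      · rw [Finset.union_insert]
        apply signsEliminable_insert heq
        · intro q hq
          rcases Finset.mem_union.mp hq with hq | hq
          exacts [(hS q hq).trans n.le_succ, hT' q hq]
        · refine (ihT (insert p.eraseLead S) hT' fun q hq => ?_).mono ?_
          · rcases Finset.mem_insert.mp hq with rfl | hq
            · exact (eraseLead_natDegree_le p).trans (by omega)
            · exact hS q hq
          · intro q
            simp only [Finset.mem_union, Finset.mem_insert]
            tauto
        · refine (ihT (S ∪ ({derivative p} ∪ (insert (derivative p) (S ∪ T)).biUnion fun q =>
            (Finset.range (n + 2)).image fun k => cancelLead p q (n + 1) k)) hT'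
            fun q hq => ?_).mono ?_
          · rcases Finset.mem_union.mp hq with hq | hq
            · exact hS q hq
            rcases Finset.mem_union.mp hq with hq | hq
            · rw [Finset.mem_singleton.mp hq]
              exact (natDegree_derivative_le p).trans (by omega)
            · obtain ⟨f, -, hf⟩ := Finset.mem_biUnion.mp hq
              obtain ⟨k, hk, rfl⟩ := Finset.mem_image.mp hf
              exact natDegree_cancelLead_le heq.le (by have := Finset.mem_range.mp hk; omega)
          · intro q
            simp only [Finset.mem_union]
            tauto

end Elimination

/-! ### Quantifier elimination for the ordered field of the reals -/

section QuantifierElimination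

open FirstOrder.Language

/-- The points `v` and `w` give the same signs to the polynomials in `P`. -/
def SameSigns {R α : Type*} [CommRing R] [Algebra R ℝ] (P : Finset (MvPolynomial α R))
    (v w : α → ℝ) : Prop :=
  ∀ f ∈ P, SignType.sign (MvPolynomial.aeval v f) = SignType.sign (MvPolynomial.aeval w f)

theorem SameSigns.symm {R α : Type*} [CommRing R] [Algebra R ℝ] {P : Finset (MvPolynomial α R)}
    {v w : α → ℝ} (h : SameSigns P v w) : SameSigns P w v := fun f hf => (h f hf).symm

theorem SameSigns.mono {R α : Type*} [CommRing R] [Algebra R ℝ] {P Q : Finset (MvPolynomial α R)}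
    {v w : α → ℝ} (h : SameSigns Q v w) (hPQ : P ⊆ Q) : SameSigns P v w :=
  fun f hf => h f (hPQ hf)

/-- Elimination of the last variable: the polynomials in `P`, in the variables `γ` and one more
variable, have the same sign patterns over points which give the same signs to finitely many
polynomials in the variables `γ`. -/
theorem exists_finset_sameSigns {R β γ : Type*} [CommRing R] [Algebra R ℝ]
    (P : Finset (MvPolynomial β R)) (e : (γ → ℝ) → ℝ → β → ℝ)
    (c : β → Option γ) (he : ∀ v y b, e v y b = (c b).elim y v) :
    ∃ Q : Finset (MvPolynomial γ R), ∀ v w : γ → ℝ, SameSigns Q v w →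
      ∀ y, ∃ y', SameSigns P (e v y) (e w y') := by
  classical
  let Φ : MvPolynomial β R →ₐ[R] Polynomial (MvPolynomial γ R) :=
    MvPolynomial.aeval fun b => (c b).elim Polynomial.X fun i => Polynomial.C (MvPolynomial.X i)
  have hΦ : ∀ v y f, ((Φ f).map (MvPolynomial.aeval (R := R) v).toRingHom).eval y =
      MvPolynomial.aeval (e v y) f := by
    intro v y f
    induction f using MvPolynomial.induction_on with
    | C a =>
      simp [Φ, MvPolynomial.algebraMap_eq, Polynomial.algebraMap_apply]
    | add f g hf hg =>
      simp only [map_add, Polynomial.map_add, Polynomial.eval_add, hf, hg]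
    | mul_X f i hf =>
      rw [map_mul, Polynomial.map_mul, Polynomial.eval_mul, hf, map_mul]
      congr 1
      simp only [Φ, MvPolynomial.aeval_X, he]
      rcases c i with _ | j <;> simp
  obtain ⟨Q, hQ⟩ := signsEliminable (P.image Φ)
  refine ⟨Q, fun v w hvw y => ?_⟩
  obtain ⟨h, hh⟩ := hQ (MvPolynomial.aeval (R := R) v).toRingHom
    (MvPolynomial.aeval (R := R) w).toRingHom hvw
  refine ⟨h y, fun f hf => ?_⟩
  rw [← hΦ, ← hΦ]
  exact hh _ (Finset.mem_image_of_mem _ hf) y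

theorem exists_aeval_eq_realize {γ : Type*} (t : rcfLanguage.Term γ) :
    ∃ f : MvPolynomial γ ℤ, ∀ v : γ → ℝ, t.realize v = MvPolynomial.aeval v f := by
  induction t with
  | var i => exact ⟨MvPolynomial.X i, fun v => by simp⟩
  | @func l F ts ih =>
    choose f hf using ih
    rcases F with F | F
    · cases F with
      | add =>
        refine ⟨f 0 + f 1, fun v => ?_⟩
        rw [map_add, ← hf, ← hf]
        exact FirstOrder.Ring.CompatibleRing.funMap_add (R := ℝ) (fun i => (ts i).realize v)
      | mul =>
        refine ⟨f 0 * f 1, fun v => ?_⟩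
        rw [map_mul, ← hf, ← hf]
        exact FirstOrder.Ring.CompatibleRing.funMap_mul (R := ℝ) (fun i => (ts i).realize v)
      | neg =>
        refine ⟨-f 0, fun v => ?_⟩
        rw [map_neg, ← hf]
        exact FirstOrder.Ring.CompatibleRing.funMap_neg (R := ℝ) (fun i => (ts i).realize v)
      | zero =>
        refine ⟨0, fun v => ?_⟩
        rw [map_zero]
        exact FirstOrder.Ring.CompatibleRing.funMap_zero (R := ℝ) (fun i => (ts i).realize v)
      | one =>
        refine ⟨1, fun v => ?_⟩
        rw [map_one]
        exact FirstOrder.Ring.CompatibleRing.funMap_one (R := ℝ) (fun i => (ts i).realize v)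
    · exact isEmptyElim F

/-- Tarski's quantifier elimination: the truth of a formula at a point is determined by the signs of
finitely many polynomials with integer coefficients. -/
theorem exists_finset_realize_iff {γ : Type*} {n : ℕ} (φ : rcfLanguage.BoundedFormula γ n) :
    ∃ P : Finset (MvPolynomial (γ ⊕ Fin n) ℤ), ∀ (v w : γ → ℝ) (x y : Fin n → ℝ),
      SameSigns P (Sum.elim v x) (Sum.elim w y) → (φ.Realize v x ↔ φ.Realize w y) := by
  classical
  induction φ with
  | falsum => exact ⟨∅, fun _ _ _ _ _ => Iff.rfl⟩
  | equal t₁ t₂ =>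
    obtain ⟨f, hf⟩ := exists_aeval_eq_realize t₁
    obtain ⟨g, hg⟩ := exists_aeval_eq_realize t₂
    refine ⟨{f - g}, fun v w x y h => ?_⟩
    have := h _ (Finset.mem_singleton_self _)
    rw [map_sub (MvPolynomial.aeval (R := ℤ) (Sum.elim v x)),
        map_sub (MvPolynomial.aeval (R := ℤ) (Sum.elim w y))] at this
    change t₁.realize (Sum.elim v x) = t₂.realize (Sum.elim v x) ↔
      t₁.realize (Sum.elim w y) = t₂.realize (Sum.elim w y)
    rw [hf, hf, hg, hg, ← sub_eq_zero, ← sign_eq_zero_iff, this, sign_eq_zero_iff, sub_eq_zero]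
  | @rel n l R ts =>
    rcases R with R | R
    · exact isEmptyElim R
    · cases R
      obtain ⟨f, hf⟩ := exists_aeval_eq_realize (ts 0)
      obtain ⟨g, hg⟩ := exists_aeval_eq_realize (ts 1)
      refine ⟨{g - f}, fun v w x y h => ?_⟩
      have := h _ (Finset.mem_singleton_self _)
      rw [map_sub (MvPolynomial.aeval (R := ℤ) (Sum.elim v x)),
        map_sub (MvPolynomial.aeval (R := ℤ) (Sum.elim w y))] at this
      change (ts 0).realize (Sum.elim v x) ≤ (ts 1).realize (Sum.elim v x) ↔
        (ts 0).realize (Sum.elim w y) ≤ (ts 1).realize (Sum.elim w y)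
      rw [hf, hf, hg, hg, ← sub_nonneg, ← sign_nonneg_iff, this, sign_nonneg_iff, sub_nonneg]
  | imp _ _ ih₁ ih₂ =>
    obtain ⟨P, hP⟩ := ih₁
    obtain ⟨Q, hQ⟩ := ih₂
    refine ⟨P ∪ Q, fun v w x y h => ?_⟩
    rw [BoundedFormula.realize_imp, BoundedFormula.realize_imp,
      hP v w x y (h.mono Finset.subset_union_left), hQ v w x y (h.mono Finset.subset_union_right)]
  | @all n φ ih =>
    obtain ⟨P, hP⟩ := ih
    obtain ⟨Q, hQ⟩ := exists_finset_sameSigns (γ := γ ⊕ Fin n) P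
      (fun v y => Sum.elim (v ∘ Sum.inl) (Fin.snoc (v ∘ Sum.inr) y))
      (Sum.elim (fun i => some (Sum.inl i)) (Fin.lastCases none fun j => some (Sum.inr j))) (by
        rintro v y (b | b)
        · rfl
        · refine Fin.lastCases ?_ (fun j => ?_) b <;> simp)
    have key : ∀ (v w : γ → ℝ) (x y : Fin n → ℝ), SameSigns Q (Sum.elim v x) (Sum.elim w y) →
        φ.all.Realize v x → φ.all.Realize w y := by
      intro v w x y h hv
      rw [BoundedFormula.realize_all] at hv ⊢
      intro a
      obtain ⟨a', ha'⟩ := hQ _ _ h.symm a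
      exact (hP w v (Fin.snoc y a) (Fin.snoc x a') ha').mpr (hv a')
    exact ⟨Q, fun v w x y h => ⟨key v w x y h, key w v y x h.symm⟩⟩

/-- A set definable over a subfield `K` is described by the signs of finitely many polynomials with
coefficients in `K`. -/
theorem exists_finset_mem_iff_of_definable {α : Type*} {A : Set ℝ} {K : Subfield ℝ}
    (hA : A ⊆ K) {S : Set (α → ℝ)} (hS : A.Definable rcfLanguage S) :
    ∃ P : Finset (MvPolynomial α K), ∀ v w, SameSigns P v w → (v ∈ S ↔ w ∈ S) := by
  classical
  obtain ⟨φ, rfl⟩ := Set.definable_iff_exists_formula_sum.mp hS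
  obtain ⟨P, hP⟩ := exists_finset_realize_iff φ
  let Ψ : MvPolynomial ((A ⊕ α) ⊕ Fin 0) ℤ →ₐ[ℤ] MvPolynomial α K :=
    MvPolynomial.aeval (Sum.elim (Sum.elim (fun a => MvPolynomial.C ⟨a, hA a.2⟩) MvPolynomial.X)
      Fin.elim0)
  have hΨ : ∀ (v : α → ℝ) (x : Fin 0 → ℝ) f, MvPolynomial.aeval v (Ψ f) =
      MvPolynomial.aeval (Sum.elim (Sum.elim (fun a : A => (a : ℝ)) v) x) f := by
    intro v x f
    induction f using MvPolynomial.induction_on with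
    | C a => simp [Ψ]
    | add f g hf hg => simp only [map_add, hf, hg]
    | mul_X f i hf =>
      rw [map_mul, map_mul, hf, map_mul]
      congr 1
      rcases i with (i | i) | i
      · simp only [Ψ, MvPolynomial.aeval_X, Sum.elim_inl, MvPolynomial.aeval_C]
        rfl
      · simp [Ψ]
      · exact i.elim0
  refine ⟨P.image Ψ, fun v w hvw => ?_⟩
  rw [Set.mem_ofPred_eq, Set.mem_ofPred_eq]
  unfold Formula.Realize
  refine hP (Sum.elim (fun a : A => (a : ℝ)) v) (Sum.elim (fun a : A => (a : ℝ)) w) _ _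
    fun f hf => ?_
  rw [← hΨ, ← hΨ]
  exact hvw _ (Finset.mem_image_of_mem _ hf)

theorem exists_mem_sameSigns_of_polynomials {F : Subfield ℝ}
    (hF : ∀ c : ℝ, IsAlgebraic F c → c ∈ F)
    (P : Finset (Polynomial F)) (y : ℝ) :
    ∃ z ∈ F, ∀ f ∈ P,
      SignType.sign (Polynomial.aeval y f) = SignType.sign (Polynomial.aeval z f) := by
  by_cases h : ∃ f ∈ P, f ≠ 0 ∧ Polynomial.aeval y f = 0
  · obtain ⟨f, -, hf0, hf⟩ := h
    exact ⟨y, hF y ⟨f, hf0, hf⟩, fun _ _ => rfl⟩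
  push Not at h
  have hev : ∀ᶠ z in 𝓝 y, ∀ f ∈ P,
      SignType.sign (Polynomial.aeval y f) = SignType.sign (Polynomial.aeval z f) := by
    rw [Filter.eventually_all_finset]
    intro f hf
    by_cases hf0 : f = 0
    · simp [hf0]
    have hc : ContinuousAt (fun z : ℝ => Polynomial.aeval z f) y :=
      (Polynomial.continuous_aeval f).continuousAt
    rcases (h f hf hf0).lt_or_gt with h1 | h1
    · filter_upwards [hc.eventually_lt continuousAt_const h1] with z hz
      rw [sign_neg h1, sign_neg hz]
    · filter_upwards [continuousAt_const.eventually_lt hc h1] with z hz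
      rw [sign_pos h1, sign_pos hz]
  obtain ⟨z, hz⟩ := (Rat.isDenseEmbedding_coe_real.dense.inter_nhds_nonempty hev)
  obtain ⟨⟨q, rfl⟩, hq⟩ := hz
  exact ⟨q, SubfieldClass.ratCast_mem F q, hq⟩

/-- Over a relatively algebraically closed subfield `F` of the reals, every sign condition which can
be satisfied can be satisfied by a point with coordinates in `F`. -/
theorem exists_mem_sameSigns {F : Subfield ℝ} (hF : ∀ c : ℝ, IsAlgebraic F c → c ∈ F) {n : ℕ}
    (P : Finset (MvPolynomial (Fin n) F)) (v : Fin n → ℝ) :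
    ∃ w : Fin n → ℝ, (∀ i, w i ∈ F) ∧ SameSigns P v w := by
  classical
  induction n with
  | zero => exact ⟨v, fun i => i.elim0, fun _ _ => rfl⟩
  | succ n ih =>
    obtain ⟨Q, hQ⟩ := exists_finset_sameSigns (γ := Fin n) P (fun v y => Fin.snoc v y)
      (Fin.lastCases none some) (by
        intro v y b
        refine Fin.lastCases ?_ (fun j => ?_) b <;> simp)
    obtain ⟨w, hwF, hw⟩ := ih Q (Fin.init v)
    obtain ⟨y, hy⟩ := hQ _ _ hw (v (Fin.last n))
    rw [Fin.snoc_init_self] at hy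
    let Θ : MvPolynomial (Fin (n + 1)) F →ₐ[F] Polynomial F :=
      MvPolynomial.aeval (Fin.snoc (α := fun _ => Polynomial F)
        (fun i => Polynomial.C ⟨w i, hwF i⟩) Polynomial.X)
    have hΘ : ∀ (z : ℝ) f, Polynomial.aeval z (Θ f) =
        MvPolynomial.aeval (Fin.snoc (α := fun _ => ℝ) w z) f := by
      intro z f
      rw [← AlgHom.comp_apply]
      congr 1
      apply MvPolynomial.algHom_ext
      intro i
      refine Fin.lastCases ?_ (fun j => ?_) i
      · simp [Θ]
      · simp only [Θ, AlgHom.comp_apply, MvPolynomial.aeval_X, Fin.snoc_castSucc,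
          Polynomial.aeval_C]
        rfl
    obtain ⟨z, hzF, hz⟩ := exists_mem_sameSigns_of_polynomials hF (P.image Θ) y
    refine ⟨Fin.snoc w z, fun i => ?_, fun f hf => ?_⟩
    · refine Fin.lastCases ?_ (fun j => ?_) i
      · simpa using hzF
      · simpa using hwF j
    · rw [hy f hf, ← hΘ, ← hΘ]
      exact hz _ (Finset.mem_image_of_mem _ hf)

/-- The Tarski-Vaught property: a nonempty set definable over a relatively algebraically closed
subfield `F` of the reals has a point with coordinates in `F`. -/
theorem exists_mem_of_definable {F : Subfield ℝ} (hF : ∀ c : ℝ, IsAlgebraic F c → c ∈ F) {n : ℕ}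
    {S : Set (Fin n → ℝ)} (hS : (F : Set ℝ).Definable rcfLanguage S) (hne : S.Nonempty) :
    ∃ w ∈ S, ∀ i, w i ∈ F := by
  obtain ⟨v, hv⟩ := hne
  obtain ⟨P, hP⟩ := exists_finset_mem_iff_of_definable (K := F) subset_rfl hS
  obtain ⟨w, hwF, hw⟩ := exists_mem_sameSigns hF P v
  exact ⟨w, (hP v w hw).mp hv, hwF⟩

/-- A set definable over `K` is a neighborhood of each of its points with coordinates algebraically
independent over `K`. -/
theorem mem_nhds_of_algebraicIndependent {α : Type*} {K : Subfield ℝ} {S : Set (α → ℝ)}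
    (hS : (K : Set ℝ).Definable rcfLanguage S) {t : α → ℝ} (ht : t ∈ S)
    (hind : AlgebraicIndependent K t) : S ∈ 𝓝 t := by
  obtain ⟨P, hP⟩ := exists_finset_mem_iff_of_definable (K := K) subset_rfl hS
  have hev : ∀ᶠ z in 𝓝 t, ∀ f ∈ P,
      SignType.sign (MvPolynomial.aeval t f) = SignType.sign (MvPolynomial.aeval z f) := by
    rw [Filter.eventually_all_finset]
    intro f hf
    by_cases hf0 : f = 0
    · simp [hf0]
    have hft : MvPolynomial.aeval t f ≠ 0 := fun h => hf0 (hind.eq_zero_of_aeval_eq_zero f h)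
    have heq : (fun z : α → ℝ => MvPolynomial.aeval z f) =
        fun z => MvPolynomial.eval z (f.map (algebraMap K ℝ)) := by
      funext z
      rw [MvPolynomial.eval_map, MvPolynomial.aeval_def]
    have hc : ContinuousAt (fun z : α → ℝ => MvPolynomial.aeval z f) t := by
      rw [heq]
      exact (MvPolynomial.continuous_eval _).continuousAt
    rcases hft.lt_or_gt with h1 | h1
    · filter_upwards [hc.eventually_lt continuousAt_const h1] with z hz
      rw [sign_neg h1, sign_neg hz]
    · filter_upwards [continuousAt_const.eventually_lt hc h1] with z hz
      rw [sign_pos h1, sign_pos hz]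
  filter_upwards [hev] with z hz
  exact (hP t z hz).mp ht

end QuantifierElimination

/-! ### Definable predicates -/

section Definability

open FirstOrder.Language

/-- `f` is given by a term of the language of ordered rings with parameters in `A`. -/
def IsTermFun {α : Type*} (A : Set ℝ) (f : (α → ℝ) → ℝ) : Prop :=
  ∃ t : rcfLanguage.Term (A ⊕ α), ∀ v, t.realize (Sum.elim (fun a : A => (a : ℝ)) v) = f v

namespace IsTermFun

variable {α : Type*} {A : Set ℝ} {f g : (α → ℝ) → ℝ}

theorem var (i : α) : IsTermFun A fun v : α → ℝ => v i :=
  ⟨Term.var (Sum.inr i), fun _ => rfl⟩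

theorem const {c : ℝ} (hc : c ∈ A) : IsTermFun A fun _ : α → ℝ => c :=
  ⟨Term.var (Sum.inl ⟨c, hc⟩), fun _ => rfl⟩

theorem zero : IsTermFun A fun _ : α → ℝ => 0 :=
  ⟨Term.func (Sum.inl FirstOrder.Ring.zeroFunc) Fin.elim0, fun _ =>
    FirstOrder.Ring.CompatibleRing.funMap_zero (R := ℝ) (fun i => i.elim0)⟩

theorem one : IsTermFun A fun _ : α → ℝ => 1 :=
  ⟨Term.func (Sum.inl FirstOrder.Ring.oneFunc) Fin.elim0, fun _ =>
    FirstOrder.Ring.CompatibleRing.funMap_one (R := ℝ) (fun i => i.elim0)⟩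

theorem add (hf : IsTermFun A f) (hg : IsTermFun A g) : IsTermFun A fun v => f v + g v := by
  obtain ⟨s, hs⟩ := hf
  obtain ⟨t, ht⟩ := hg
  refine ⟨Term.func (Sum.inl FirstOrder.Ring.addFunc) ![s, t], fun v => ?_⟩
  simp only [← hs, ← ht]
  exact FirstOrder.Ring.CompatibleRing.funMap_add (R := ℝ) fun i =>
    (![s, t] i).realize (Sum.elim (fun a : A => (a : ℝ)) v)

theorem mul (hf : IsTermFun A f) (hg : IsTermFun A g) : IsTermFun A fun v => f v * g v := by
  obtain ⟨s, hs⟩ := hf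
  obtain ⟨t, ht⟩ := hg
  refine ⟨Term.func (Sum.inl FirstOrder.Ring.mulFunc) ![s, t], fun v => ?_⟩
  simp only [← hs, ← ht]
  exact FirstOrder.Ring.CompatibleRing.funMap_mul (R := ℝ) fun i =>
    (![s, t] i).realize (Sum.elim (fun a : A => (a : ℝ)) v)

theorem neg (hf : IsTermFun A f) : IsTermFun A fun v => -f v := by
  obtain ⟨s, hs⟩ := hf
  refine ⟨Term.func (Sum.inl FirstOrder.Ring.negFunc) ![s], fun v => ?_⟩
  simp only [← hs]
  exact FirstOrder.Ring.CompatibleRing.funMap_neg (R := ℝ) fun i =>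
    (![s] i).realize (Sum.elim (fun a : A => (a : ℝ)) v)

theorem sub (hf : IsTermFun A f) (hg : IsTermFun A g) : IsTermFun A fun v => f v - g v := by
  simpa only [sub_eq_add_neg] using hf.add hg.neg

theorem pow (hf : IsTermFun A f) (n : ℕ) : IsTermFun A fun v => f v ^ n := by
  induction n with
  | zero => simpa using one
  | succ n ih => simpa only [pow_succ] using ih.mul hf

theorem sum {ι : Type*} (s : Finset ι) {F : ι → (α → ℝ) → ℝ} (hF : ∀ i ∈ s, IsTermFun A (F i)) :
    IsTermFun A fun v => ∑ i ∈ s, F i v := by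
  classical
  induction s using Finset.induction_on with
  | empty => simpa using zero
  | insert i s hi ih =>
    simp only [Finset.sum_insert hi]
    exact (hF i (Finset.mem_insert_self _ _)).add
      (ih fun j hj => hF j (Finset.mem_insert_of_mem hj))

theorem prod {ι : Type*} (s : Finset ι) {F : ι → (α → ℝ) → ℝ} (hF : ∀ i ∈ s, IsTermFun A (F i)) :
    IsTermFun A fun v => ∏ i ∈ s, F i v := by
  classical
  induction s using Finset.induction_on with
  | empty => simpa using one
  | insert i s hi ih =>
    simp only [Finset.prod_insert hi]
    exact (hF i (Finset.mem_insert_self _ _)).mul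
      (ih fun j hj => hF j (Finset.mem_insert_of_mem hj))

theorem eval {p : MvPolynomial α ℝ} (hp : ∀ m ∈ p.support, p.coeff m ∈ A) :
    IsTermFun A fun v => MvPolynomial.eval v p := by
  simp only [MvPolynomial.eval_eq]
  exact sum _ fun m hm => (const (hp m hm)).mul (prod _ fun i _ => (var i).pow _)

end IsTermFun

/-- The symbol `≤` of the language of ordered rings. -/
def rcfLeSymb : rcfLanguage.Relations 2 := Sum.inr leSymb

/-- The predicate `P` is definable in the ordered field of the reals with parameters in `A`. -/
def IsDefinable {α : Type*} (A : Set ℝ) (P : (α → ℝ) → Prop) : Prop :=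
  A.Definable rcfLanguage {v | P v}

namespace IsDefinable

variable {α β : Type*} {A B : Set ℝ} {P Q : (α → ℝ) → Prop} {f g : (α → ℝ) → ℝ}

theorem mono (hP : IsDefinable A P) (hAB : A ⊆ B) : IsDefinable B P := Set.Definable.mono hP hAB

theorem and (hP : IsDefinable A P) (hQ : IsDefinable A Q) : IsDefinable A fun v => P v ∧ Q v :=
  Set.Definable.inter hP hQ

theorem not (hP : IsDefinable A P) : IsDefinable A fun v => ¬ P v := Set.Definable.compl hP

theorem or (hP : IsDefinable A P) (hQ : IsDefinable A Q) : IsDefinable A fun v => P v ∨ Q v :=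
  Set.Definable.union hP hQ

theorem imp (hP : IsDefinable A P) (hQ : IsDefinable A Q) : IsDefinable A fun v => P v → Q v := by
  simpa only [imp_iff_not_or] using hP.not.or hQ

theorem iff (hP : IsDefinable A P) (hQ : IsDefinable A Q) : IsDefinable A fun v => P v ↔ Q v := by
  simpa only [iff_iff_implies_and_implies] using (hP.imp hQ).and (hQ.imp hP)

theorem comp (hP : IsDefinable A P) (f : α → β) :
    IsDefinable A fun v : β → ℝ => P fun i => v (f i) :=
  Set.Definable.preimage_comp f hP

theorem forall_mem {ι : Type*} [Finite ι] {R : ι → (α → ℝ) → Prop}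
    (hR : ∀ i, IsDefinable A (R i)) : IsDefinable A fun v => ∀ i, R i v := by
  have := Set.definable_iInter_of_finite hR
  rwa [← Set.ofPred_forall] at this

theorem exists_mem {ι : Type*} [Finite ι] {R : ι → (α → ℝ) → Prop}
    (hR : ∀ i, IsDefinable A (R i)) : IsDefinable A fun v => ∃ i, R i v := by
  have := Set.definable_iUnion_of_finite hR
  rwa [← Set.ofPred_exists] at this

theorem all [Finite β] {R : (α → ℝ) → (β → ℝ) → Prop}
    (hR : IsDefinable A fun v : α ⊕ β → ℝ => R (fun i => v (Sum.inl i)) fun j => v (Sum.inr j)) :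
    IsDefinable A fun v => ∀ u, R v u :=
  Set.Definable.forall_of_finite hR

theorem ex [Finite β] {R : (α → ℝ) → (β → ℝ) → Prop}
    (hR : IsDefinable A fun v : α ⊕ β → ℝ => R (fun i => v (Sum.inl i)) fun j => v (Sum.inr j)) :
    IsDefinable A fun v => ∃ u, R v u :=
  Set.Definable.exists_of_finite hR

theorem le (hf : IsTermFun A f) (hg : IsTermFun A g) : IsDefinable A fun v => f v ≤ g v := by
  obtain ⟨s, hs⟩ := hf
  obtain ⟨t, ht⟩ := hg
  rw [IsDefinable, Set.definable_iff_exists_formula_sum]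
  refine ⟨Relations.formula₂ rcfLeSymb s t, ?_⟩
  ext v
  simp only [Set.mem_ofPred_eq]
  rw [← hs, ← ht]
  exact (Formula.realize_rel₂ (M := ℝ) (R := rcfLeSymb) (t₁ := s) (t₂ := t)
    (v := Sum.elim (fun a : A => (a : ℝ)) v)).symm

theorem lt (hf : IsTermFun A f) (hg : IsTermFun A g) : IsDefinable A fun v => f v < g v := by
  simpa only [not_le] using (le hg hf).not

theorem eq (hf : IsTermFun A f) (hg : IsTermFun A g) : IsDefinable A fun v => f v = g v := by
  simpa only [le_antisymm_iff] using (le hf hg).and (le hg hf)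

end IsDefinable

/-- The parameters of a definable predicate can be replaced by variables. -/
theorem exists_isDefinable_of_union {α : Type*} {F a : Set ℝ} {P : (α → ℝ) → Prop}
    (hP : IsDefinable (F ∪ a) P) :
    ∃ R : (a → ℝ) → (α → ℝ) → Prop,
      (IsDefinable F fun v : a ⊕ α → ℝ => R (fun i => v (Sum.inl i)) fun j => v (Sum.inr j)) ∧
      ∀ v, R (fun b => b) v ↔ P v := by
  classical
  obtain ⟨φ, hφ⟩ := Set.definable_iff_exists_formula_sum.mp hP
  let e : (F ∪ a : Set ℝ) ⊕ α → F ⊕ (a ⊕ α) :=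
    Sum.elim (fun b => if h : (b : ℝ) ∈ F then Sum.inl ⟨b, h⟩ else
      Sum.inr (Sum.inl ⟨b, b.2.resolve_left h⟩)) fun i => Sum.inr (Sum.inr i)
  refine ⟨fun y v => (φ.relabel e).Realize (Sum.elim (fun b : F => (b : ℝ)) (Sum.elim y v)),
    ?_, fun v => ?_⟩
  · rw [IsDefinable, Set.definable_iff_exists_formula_sum]
    refine ⟨φ.relabel e, ?_⟩
    ext v
    simp only [Set.mem_ofPred_eq]
    have : Sum.elim (fun i => v (Sum.inl i)) (fun j => v (Sum.inr j)) = v := by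
      ext (i | i) <;> rfl
    rw [this]
  · have h1 : P v ↔ v ∈ {v | P v} := Iff.rfl
    rw [h1, hφ, Set.mem_ofPred_eq]
    simp only [Formula.realize_relabel]
    have : Sum.elim (fun b : F => (b : ℝ)) (Sum.elim (fun b : a => (b : ℝ)) v) ∘ e =
        Sum.elim (fun b : (F ∪ a : Set ℝ) => (b : ℝ)) v := by
      ext (b | i)
      · simp only [e, Function.comp_apply, Sum.elim_inl]
        split_ifs <;> rfl
      · rfl
    rw [this]

end Definability

/-! ### The sets `D` over an extension of the field of parameters -/

section Transfer

/-- By Hilbert's basis theorem an arbitrary intersection of algebraic sets is cut out by finitely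
many polynomials, hence by the sum of their squares. -/
theorem IsAlgebraicSet.iInter {d : ℕ} {ι : Sort*} {S : ι → Set (Euc d)}
    (hS : ∀ i, IsAlgebraicSet (S i)) : IsAlgebraicSet (⋂ i, S i) := by
  let I : Ideal (MvPolynomial (Fin d) ℝ) :=
    { carrier := {p | ∀ z ∈ ⋂ i, S i, MvPolynomial.eval (fun i => z i) p = 0}
      add_mem' := fun {a b} ha hb z hz => by rw [map_add, ha z hz, hb z hz, add_zero]
      zero_mem' := fun z _ => map_zero _
      smul_mem' := fun c a ha z hz => by rw [smul_eq_mul, map_mul, ha z hz, mul_zero] }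
  obtain ⟨G, hG⟩ := IsNoetherian.noetherian I
  refine ⟨∑ g ∈ G, g * g, Set.Subset.antisymm (fun z hz => ?_) fun z hz => ?_⟩
  · rw [Set.mem_ofPred_eq, map_sum]
    refine Finset.sum_eq_zero fun g hg => ?_
    have hgI : g ∈ I := hG ▸ Submodule.subset_span hg
    rw [map_mul, hgI z hz, mul_zero]
  · rw [Set.mem_ofPred_eq, map_sum, Finset.sum_eq_zero_iff_of_nonneg
      fun g _ => by rw [map_mul]; exact mul_self_nonneg _] at hz
    have hI : I ≤ RingHom.ker (MvPolynomial.eval fun i => z i) := by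
      rw [← hG]
      refine Submodule.span_le.mpr fun g hg => ?_
      have := hz g hg
      rw [map_mul] at this
      exact mul_self_eq_zero.mp this
    refine Set.mem_iInter.mpr fun i => ?_
    obtain ⟨p, hp⟩ := hS i
    have hpI : p ∈ I := fun w hw => by
      have := Set.mem_iInter.mp hw i
      rw [hp] at this
      exact this
    rw [hp]
    exact hI hpI

/-- The polynomial with monomials in `N` and coefficients `c` vanishes at `z`. -/
def PolyVanishes {d : ℕ} (N : Finset (Fin d →₀ ℕ)) (c : N → ℝ) (z : Fin d → ℝ) : Prop :=
  ∑ m : N, c m * ∏ i, z i ^ (m : Fin d →₀ ℕ) i = 0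

theorem isDefinable_polyVanishes {d : ℕ} (A : Set ℝ) (N : Finset (Fin d →₀ ℕ)) :
    IsDefinable A fun v : N ⊕ Fin d → ℝ =>
      PolyVanishes N (fun i => v (Sum.inl i)) fun j => v (Sum.inr j) :=
  .eq (.sum _ fun m _ => (IsTermFun.var (Sum.inl m)).mul
    (.prod _ fun i _ => (IsTermFun.var (Sum.inr i)).pow _)) .zero

theorem isAlgebraicSet_polyVanishes {d : ℕ} (N : Finset (Fin d →₀ ℕ)) (c : N → ℝ) :
    IsAlgebraicSet {z : Euc d | PolyVanishes N c fun i => z i} := by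
  refine ⟨∑ m : N, MvPolynomial.monomial (m : Fin d →₀ ℕ) (c m), ?_⟩
  ext z
  simp only [Set.mem_ofPred_eq, PolyVanishes, map_sum, MvPolynomial.eval_monomial]
  refine Eq.congr_left (Finset.sum_congr rfl fun m _ => ?_)
  rw [Finsupp.prod_fintype _ _ fun i => pow_zero _]

theorem IsAlgebraicSet.exists_polyVanishes {d : ℕ} {S : Set (Euc d)} (hS : IsAlgebraicSet S) :
    ∃ (N : Finset (Fin d →₀ ℕ)) (c : N → ℝ), ∀ z, z ∈ S ↔ PolyVanishes N c fun i => z i := by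
  obtain ⟨p, rfl⟩ := hS
  refine ⟨p.support, fun m => p.coeff m, fun z => ?_⟩
  rw [Set.mem_ofPred_eq, MvPolynomial.eval_eq', PolyVanishes,
    ← Finset.sum_coe_sort p.support (fun m => p.coeff m * ∏ i, z i ^ m i)]

/-- An element `b` algebraic over `K(T)`, where `T` is algebraically independent over `K`, is
isolated by a formula with parameters `T` and finitely many elements of `K`. -/
theorem exists_isDefinable_isolating {K : Subfield ℝ} {T : Set ℝ}
    (hT : AlgebraicIndependent K ((↑) : T → ℝ)) {b : ℝ} (hb : IsAlgebraic (Algebra.adjoin K T) b)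
    (F : Subfield ℝ) :
    ∃ c : Set ℝ, c.Finite ∧ c ⊆ K ∧ ∃ R : (Option T → ℝ) → Prop,
      IsDefinable ((F : Set ℝ) ∪ c) R ∧
      ∀ y : ℝ, R (fun o => o.elim y (↑)) ↔ y = b := by
  classical
  have hnot : ¬ AlgebraicIndependent K fun o : Option T => o.elim b (↑) := by
    rw [hT.option_iff_transcendental b, Transcendental, not_not, Subtype.range_coe]
    exact hb
  rw [algebraicIndependent_iff] at hnot
  push Not at hnot
  obtain ⟨G, hG0, hG⟩ := hnot
  let Φ : MvPolynomial (Option T) K →ₐ[K] Polynomial ℝ :=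
    MvPolynomial.aeval fun o => o.elim Polynomial.X fun t => Polynomial.C (t : ℝ)
  have hΦ : Φ = (Polynomial.mapAlgHom (MvPolynomial.aeval ((↑) : T → ℝ))).comp
      (MvPolynomial.optionEquivLeft K T).toAlgHom := by
    apply MvPolynomial.algHom_ext
    rintro (_ | t)
    · simp [Φ]
    · simp [Φ]
  have hΦG : Φ G ≠ 0 := by
    rw [hΦ]
    intro h0
    have hinj : Function.Injective
        (Polynomial.mapAlgHom (MvPolynomial.aeval (R := K) ((↑) : T → ℝ))) :=
      Polynomial.map_injective _ hT
    exact hG (by simpa using hinj (h0.trans (map_zero _).symm))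
  have hev : ∀ y : ℝ, (Φ G).eval y = MvPolynomial.aeval (fun o : Option T => o.elim y (↑)) G := by
    intro y
    have h1 : ((Polynomial.aeval (R := ℝ) y).restrictScalars K).comp Φ =
        MvPolynomial.aeval (fun o : Option T => o.elim y (↑)) := by
      apply MvPolynomial.algHom_ext
      rintro (_ | t)
      · simp [Φ]
      · simp [Φ]
    rw [← h1, ← Polynomial.coe_aeval_eq_eval]
    rfl
  have hfin : ({y | (Φ G).eval y = 0} \ {b}).Finite := by
    refine ((Φ G).roots.toFinset.finite_toSet.subset fun y hy => ?_).sdiff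
    simpa [hΦG] using hy
  -- a rational interval separates `b` from the other roots
  obtain ⟨ε, hε, hball⟩ := Metric.mem_nhds_iff.mp
    (hfin.isClosed.isOpen_compl.mem_nhds (show b ∈ _ from fun h => h.2 rfl))
  obtain ⟨q₁, hq₁, hq₁'⟩ := exists_rat_btwn (show b - ε < b by linarith)
  obtain ⟨q₂, hq₂, hq₂'⟩ := exists_rat_btwn (show b < b + ε by linarith)
  have hqF : ∀ q : ℚ, (q : ℝ) ∈ F := fun q => SubfieldClass.ratCast_mem F q
  refine ⟨(fun m => ((G.coeff m : K) : ℝ)) '' G.support, G.support.finite_toSet.image _, ?_,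
    fun v => MvPolynomial.eval v (G.map (algebraMap K ℝ)) = 0 ∧ (q₁ : ℝ) < v none ∧
      v none < (q₂ : ℝ), ?_, fun y => ?_⟩
  · rintro _ ⟨m, -, rfl⟩
    exact (G.coeff m).2
  · refine (IsDefinable.eq (.eval fun m hm => ?_) .zero).and
      ((IsDefinable.lt (.const (Or.inl (hqF q₁))) (.var none)).and
        (.lt (.var none) (.const (Or.inl (hqF q₂)))))
    rw [MvPolynomial.coeff_map]
    exact Or.inr ⟨m, MvPolynomial.support_map_subset _ _ hm, rfl⟩
  · simp only [MvPolynomial.eval_map, ← MvPolynomial.aeval_def]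
    rw [← hev]
    constructor
    · rintro ⟨h0, h1, h2⟩
      by_contra hne
      refine hball (show y ∈ _ from ?_) ⟨h0, hne⟩
      simp only [Option.elim] at h1 h2
      rw [Metric.mem_ball, Real.dist_eq, abs_lt]
      constructor <;> linarith
    · rintro rfl
      refine ⟨?_, hq₁', hq₂⟩
      rw [hev]
      exact hG0

/-- At the points with coordinates in an extension `K` of `F`, finitely many real parameters added
to `F` can be replaced by finitely many elements of `K` without enlarging `D`, uniformly in the point.

Let `T` be a transcendence basis of the parameters `a` over `K`; each element of `a` is isolated by
a formula over `F`, `T` and finitely many elements `a'` of `K`. The set `D(F ∪ a, x)` is the fibre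
over `a` of a set `S` definable over `F`. That the fibre over the tuple defined by `t` in place of
`T` is algebraic of bounded degree and contains `x` is definable over `K`, and it holds at the
algebraically independent tuple `T`, hence in a rational box around it. The intersection of the
fibres over this box is algebraic, contains `x`, is definable over `F ∪ a'`, and is included in
`D(F ∪ a, x)`. -/
theorem exists_finite_D_subset {d : ℕ} {F K : Subfield ℝ} (hFK : F ≤ K) {a : Set ℝ}
    (ha : a.Finite) : ∃ a' : Set ℝ, a'.Finite ∧ a' ⊆ K ∧
      ∀ x : Euc d, (∀ i, x i ∈ K) → D ((F : Set ℝ) ∪ a') x ⊆ D ((F : Set ℝ) ∪ a) x := by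
  classical
  obtain ⟨T, hT⟩ := (AlgebraicIndependent.matroid K ℝ).exists_isBasis a
  obtain ⟨hTind, hTa, hTalg⟩ := AlgebraicIndependent.matroid_isBasis_iff.mp hT
  have hTind' : AlgebraicIndependent K ((↑) : T → ℝ) := hTind
  have : Fintype T := (ha.subset hTa).fintype
  have : Finite a := ha.to_subtype
  choose c hcfin hcK R hRdef hR using fun b : a =>
    exists_isDefinable_isolating hTind' (hTalg b b.2) F
  have hcU : ∀ b, (F : Set ℝ) ∪ c b ⊆ (F : Set ℝ) ∪ ⋃ b, c b := fun b =>
    Set.union_subset_union_right _ (Set.subset_iUnion c b)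
  refine ⟨⋃ b, c b, Set.finite_iUnion hcfin, Set.iUnion_subset hcK, fun x hx => ?_⟩
  have hUK : (F : Set ℝ) ∪ ⋃ b, c b ⊆ K := Set.union_subset hFK (Set.iUnion_subset hcK)
  -- `Ψ t y` says that the tuple `y` satisfies the isolating formulas of `a`, with `t` for `T`
  let Ψ : (T → ℝ) → (a → ℝ) → Prop := fun t y => ∀ b, R b fun o => o.elim (y b) t
  have hΨ : IsDefinable ((F : Set ℝ) ∪ ⋃ b, c b) fun v : T ⊕ a → ℝ =>
      Ψ (fun i => v (Sum.inl i)) fun j => v (Sum.inr j) := by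
    refine .forall_mem fun b => ?_
    have := ((hRdef b).mono (hcU b)).comp
      (fun o : Option T => o.elim (Sum.inr b) Sum.inl : Option T → T ⊕ a)
    convert this using 3 with v
    ext o
    cases o <;> rfl
  have hΨT : ∀ y, Ψ (↑) y ↔ y = fun b : a => (b : ℝ) := fun y => by
    simp only [Ψ, hR, funext_iff]
  obtain ⟨hS1, hS2, hS3⟩ := (isLeast_D ((F : Set ℝ) ∪ a) x).1
  obtain ⟨S, hSdef, hS⟩ := exists_isDefinable_of_union (P := fun v => WithLp.toLp 2 v ∈
    D ((F : Set ℝ) ∪ a) x) hS1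
  obtain ⟨N, e, he⟩ := hS2.exists_polyVanishes
  let E : (T → ℝ) → Prop := fun t => ∀ y, Ψ t y → (∃ z : Fin d → ℝ, (∀ i, z i = x i) ∧ S y z) ∧
    ∃ e : N → ℝ, ∀ z, S y z ↔ PolyVanishes N e z
  have hE : IsDefinable K E := by
    refine .all (.imp (hΨ.mono hUK) (.and (.ex (.and ?_ ?_)) (.ex (.all (.iff ?_ ?_)))))
    · exact .forall_mem fun i => .eq (.var _) (.const (hx i))
    · exact (hSdef.mono hFK).comp (Sum.elim (fun i => Sum.inl (Sum.inr i)) Sum.inr)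
    · exact (hSdef.mono hFK).comp
        (Sum.elim (fun i => Sum.inl (Sum.inl (Sum.inr i))) Sum.inr)
    · exact (isDefinable_polyVanishes _ N).comp
        (Sum.elim (fun i => Sum.inl (Sum.inr i)) Sum.inr)
  have hET : E (↑) := by
    intro y hy
    obtain rfl := (hΨT y).mp hy
    refine ⟨⟨fun i => x i, fun i => rfl, (hS _).mpr hS3⟩, e, fun z => ?_⟩
    rw [hS, he]
  obtain ⟨ε, hε, hball⟩ := (@Metric.mem_nhds_iff (T → ℝ) _ _ _).mp
    (mem_nhds_of_algebraicIndependent (S := {t | E t}) hE hET hTind')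
  choose l hl hl' using fun t : T => exists_rat_btwn (show (t : ℝ) - ε < t by linarith)
  choose u hu hu' using fun t : T => exists_rat_btwn (show (t : ℝ) < t + ε by linarith)
  let box : (T → ℝ) → Prop := fun t => ∀ i, (l i : ℝ) < t i ∧ t i < u i
  have hboxE : ∀ t, box t → E t := by
    intro t ht
    refine hball (show t ∈ _ from ?_)
    rw [Metric.mem_ball, dist_pi_lt_iff hε]
    intro i
    rw [Real.dist_eq, abs_lt]
    have h1 := ht i
    have h2 := hl i
    have h3 := hu' i
    constructor <;> linarith
  have hqF : ∀ q : ℚ, (q : ℝ) ∈ (F : Set ℝ) ∪ ⋃ b, c b :=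
    fun q => Or.inl (SubfieldClass.ratCast_mem F q)
  let S' : (Fin d → ℝ) → Prop := fun z => ∀ t : T → ℝ, box t → ∀ y : a → ℝ, Ψ t y → S y z
  have hS'def : IsDefinable ((F : Set ℝ) ∪ ⋃ b, c b) S' := by
    refine .all (.imp (.forall_mem fun i => .and (.lt (.const (hqF _)) (.var _))
      (.lt (.var _) (.const (hqF _)))) (.all (.imp ?_ ?_)))
    · exact hΨ.comp (Sum.elim (fun i => Sum.inl (Sum.inr i)) Sum.inr)
    · exact (hSdef.mono Set.subset_union_left).comp
        (Sum.elim Sum.inr fun i => Sum.inl (Sum.inl i))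
  have hmem : {z : Euc d | S' fun i => z i} ∈ algFamily ((F : Set ℝ) ∪ ⋃ b, c b) x := by
    refine ⟨hS'def, ?_, ?_⟩
    · have : {z : Euc d | S' fun i => z i} =
          ⋂ i : {ty : (T → ℝ) × (a → ℝ) // box ty.1 ∧ Ψ ty.1 ty.2},
            {z : Euc d | S i.1.2 fun i => z i} := by
        ext z
        simp only [Set.mem_ofPred_eq, Set.mem_iInter, Subtype.forall, Prod.forall, S']
        exact forall_congr' fun t => ⟨fun h y hy => h hy.1 y hy.2, fun h ht y hy => h y ⟨ht, hy⟩⟩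
      rw [this]
      refine IsAlgebraicSet.iInter fun i => ?_
      obtain ⟨e', he'⟩ := (hboxE _ i.2.1 _ i.2.2).2
      simp only [he']
      exact isAlgebraicSet_polyVanishes N e'
    · intro t ht y hy
      obtain ⟨⟨z, hz, hSz⟩, -⟩ := hboxE t ht y hy
      rwa [show z = fun i => x i from funext hz] at hSz
  refine (Set.sInter_subset_of_mem hmem).trans fun z hz => ?_
  have := hz (↑) (fun i => ⟨hl' i, hu i⟩) _ ((hΨT _).mpr rfl)
  exact (hS _).mp this

end Transfer

/-! ### Consequences of irreflexivity -/

section Irreflexivity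

variable {d : ℕ} {Γ : Set (Set (Euc d))}

theorem D_anti {A B : Set ℝ} (hAB : A ⊆ B) (x : Euc d) : D B x ⊆ D A x :=
  Set.sInter_subset_sInter fun _ hS => ⟨hS.1.mono hAB, hS.2⟩

theorem eps_le_eps_of_subset {A B : Set ℝ} {x : Euc d} (h : D A x ⊆ D B x) :
    eps Γ A x ≤ eps Γ B x :=
  biSup_mono fun _ hε => ⟨hε.1, fun ⟨b, hb, hbΓ⟩ => hε.2 ⟨b, hb, fun y hy => hbΓ y (h hy)⟩⟩

theorem eps_anti {A B : Set ℝ} (hAB : A ⊆ B) (x : Euc d) : eps Γ B x ≤ eps Γ A x :=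
  eps_le_eps_of_subset (D_anti hAB x)

theorem IsAlgebraicHypergraph.encard_eq (hΓ : IsAlgebraicHypergraph Γ) {e : Set (Euc d)}
    (he : e ∈ Γ) : e.encard = 3 := by
  obtain ⟨p, hp⟩ := hΓ
  obtain ⟨x, hx, rfl, -⟩ := (hp e).mp he
  rw [← Set.image_univ, hx.encard_image, Set.encard_univ]
  simp

/-- Distinct points have neighborhoods whose union does not include hyperedges meeting both. -/
theorem TwoIrreflexive.exists_radius {X : Type*} [PseudoMetricSpace X] {n : ℕ} {Γ : Set (Set X)}
    (hn : 2 ≤ n) (hΓ : ∀ e ∈ Γ, e.encard ≤ n) (hirr : TwoIrreflexive n Γ) {x z : X} (hxz : x ≠ z) :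
    ∃ ε > 0, ∀ e ∈ Γ, (∀ w ∈ e, dist w x < ε ∨ dist w z < ε) → (∃ w ∈ e, dist w x < ε) →
      ¬ ∃ w ∈ e, dist w z < ε := by
  by_contra! hcon
  choose e heΓ hsub hx hz using fun k : ℕ => hcon (1 / ((k : ℝ) + 1)) (by positivity)
  have hcard : ({x, z} : Set X).encard = 2 := Set.encard_pair hxz
  have hsmall : ∀ δ > 0, ∀ᶠ k : ℕ in Filter.atTop, 1 / ((k : ℝ) + 1) < δ := fun δ hδ =>
    tendsto_one_div_add_atTop_nhds_zero_nat.eventually_lt_const hδ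
  let : TopologicalSpace (Set X) := TopologicalSpace.vietoris X
  have hlim : Filter.Tendsto e Filter.atTop (𝓝 {x, z}) := by
    rw [TopologicalSpace.tendsto_nhds_generateFrom_iff]
    rintro s (⟨U, hU, rfl⟩ | ⟨V, hV, rfl⟩) hs
    · obtain ⟨δ₁, hδ₁, h₁⟩ := Metric.isOpen_iff.mp hU x (hs (by simp))
      obtain ⟨δ₂, hδ₂, h₂⟩ := Metric.isOpen_iff.mp hU z (hs (by simp))
      filter_upwards [hsmall δ₁ hδ₁, hsmall δ₂ hδ₂] with k hk₁ hk₂ w hw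
      rcases hsub k w hw with h | h
      · exact h₁ (h.trans hk₁)
      · exact h₂ (h.trans hk₂)
    · obtain ⟨y, hy, hyV⟩ := hs
      obtain ⟨δ, hδ, h⟩ := Metric.isOpen_iff.mp hV y hyV
      filter_upwards [hsmall δ hδ] with k hk
      rcases hy with rfl | rfl
      · obtain ⟨w, hw, hwx⟩ := hx k
        exact ⟨w, hw, h (hwx.trans hk)⟩
      · obtain ⟨w, hw, hwz⟩ := hz k
        exact ⟨w, hw, h (hwz.trans hk)⟩
  let K : {s : Set X // s.encard ≤ n} := ⟨{x, z}, by rw [hcard]; exact_mod_cast hn⟩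
  refine hirr K (mem_closure_of_tendsto (f := fun k => ⟨e k, hΓ _ (heΓ k)⟩) (b := Filter.atTop) ?_
    (Filter.Eventually.of_forall heΓ)) hcard
  rw [tendsto_subtype_rng]
  exact hlim

/-- The parameter `ε` is positive at the points with a coordinate outside of the relatively
algebraically closed field of parameters: the set `D` then contains another point. -/
theorem eps_pos (hΓ : IsAlgebraicHypergraph Γ) (hirr : TwoIrreflexive 3 Γ) {F : Subfield ℝ}
    (hF : ∀ c : ℝ, IsAlgebraic F c → c ∈ F) {x : Euc d} (hx : ¬ ∀ i, x i ∈ F) :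
    0 < eps Γ F x := by
  obtain ⟨hD1, -, hD3⟩ := (isLeast_D (F : Set ℝ) x).1
  obtain ⟨z, hzD, hzF⟩ := exists_mem_of_definable hF hD1 ⟨fun i => x i, hD3⟩
  have hxz : x ≠ WithLp.toLp 2 z := by
    rintro rfl
    exact hx hzF
  obtain ⟨ε, hε, hsep⟩ := hirr.exists_radius (by norm_num)
    (fun e he => (hΓ.encard_eq he).le) hxz
  have hgood : IsGoodRadius Γ F x (min ε (dist (WithLp.toLp 2 z) x)) := by
    rintro ⟨b, hb, hbΓ⟩
    have hzb : WithLp.toLp 2 z ∉ b := fun h => (lt_irrefl _) ((hb _ h).trans_le (min_le_right _ _))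
    have he := hbΓ _ hzD hxz.symm hzb
    have hne : b.Nonempty := by
      rw [Set.nonempty_iff_ne_empty]
      rintro rfl
      have := hΓ.encard_eq he
      rw [Set.empty_union, Set.encard_singleton] at this
      exact absurd this (by norm_num)
    obtain ⟨w, hw⟩ := hne
    refine hsep _ he ?_ ⟨w, Or.inl hw, (hb w hw).trans_le (min_le_left _ _)⟩
      ⟨_, Or.inr rfl, by simpa using hε⟩
    rintro y (hy | rfl)
    · exact Or.inl ((hb y hy).trans_le (min_le_left _ _))
    · exact Or.inr (by simpa using hε)
  have hpos : 0 < min ε (dist (WithLp.toLp 2 z) x) := lt_min hε (dist_pos.mpr hxz.symm)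
  refine (ENNReal.ofReal_pos.mpr hpos).trans_le ?_
  exact le_biSup (fun ε : ℝ => ENNReal.ofReal ε)
    (show _ ∈ {ε : ℝ | 0 < ε ∧ IsGoodRadius Γ F x ε} from ⟨hpos, hgood⟩)

/-- Over a subfield `F`, a real polynomial can be replaced by finitely many polynomials with
coefficients in `F`, its components with respect to a basis of `ℝ` over `F`: their common zeros are
zeros of the polynomial, and conversely for the points with coordinates in `F`. -/
theorem exists_components {σ : Type*} (F : Subfield ℝ) (q : MvPolynomial σ ℝ) :
    ∃ Q : Finset (MvPolynomial σ ℝ), (∀ g ∈ Q, ∀ m, g.coeff m ∈ F) ∧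
      (∀ v, (∀ g ∈ Q, MvPolynomial.eval v g = 0) → MvPolynomial.eval v q = 0) ∧
      ∀ v, (∀ i, v i ∈ F) → MvPolynomial.eval v q = 0 → ∀ g ∈ Q, MvPolynomial.eval v g = 0 := by
  classical
  let B := Module.Basis.ofVectorSpace F ℝ
  let J := q.support.biUnion fun m => (B.repr (q.coeff m)).support
  let g := fun j => ∑ m ∈ q.support, MvPolynomial.monomial m ((B.repr (q.coeff m) j : F) : ℝ)
  have hg : ∀ j v, MvPolynomial.eval v (g j) =
      ∑ m ∈ q.support, ((B.repr (q.coeff m) j : F) : ℝ) * ∏ i ∈ m.support, v i ^ m i := by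
    intro j v
    simp only [g, map_sum, MvPolynomial.eval_monomial]
    rfl
  refine ⟨J.image g, ?_, fun v hv => ?_, fun v hvF hv => ?_⟩
  · intro f hf m
    obtain ⟨j, -, rfl⟩ := Finset.mem_image.mp hf
    simp only [g, MvPolynomial.coeff_sum, MvPolynomial.coeff_monomial]
    refine sum_mem fun m' _ => ?_
    split_ifs
    exacts [(B.repr (q.coeff m') j).2, zero_mem F]
  · have hc : ∀ m ∈ q.support, q.coeff m = ∑ j ∈ J, ((B.repr (q.coeff m) j : F) : ℝ) * B j := by
      intro m hm
      conv_lhs => rw [← B.linearCombination_repr (q.coeff m)]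
      rw [Finsupp.linearCombination_apply, Finsupp.sum]
      refine Finset.sum_subset (Finset.subset_biUnion_of_mem
        (fun m => (B.repr (q.coeff m)).support) hm) fun j _ hj => ?_
      rw [Finsupp.notMem_support_iff.mp hj, zero_smul]
    rw [MvPolynomial.eval_eq]
    calc ∑ m ∈ q.support, q.coeff m * ∏ i ∈ m.support, v i ^ m i
        = ∑ m ∈ q.support, ∑ j ∈ J, B j *
            (((B.repr (q.coeff m) j : F) : ℝ) * ∏ i ∈ m.support, v i ^ m i) := by
          refine Finset.sum_congr rfl fun m hm => ?_
          conv_lhs => rw [hc m hm]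
          rw [Finset.sum_mul]
          exact Finset.sum_congr rfl fun j _ => by ring
      _ = ∑ j ∈ J, B j * MvPolynomial.eval v (g j) := by
          rw [Finset.sum_comm]
          exact Finset.sum_congr rfl fun j _ => by rw [hg, Finset.mul_sum]
      _ = 0 := Finset.sum_eq_zero fun j hj => by
          rw [hv _ (Finset.mem_image_of_mem g hj), mul_zero]
  · intro f hf
    obtain ⟨j, -, rfl⟩ := Finset.mem_image.mp hf
    let w : σ → F := fun i => ⟨v i, hvF i⟩
    have h1 : MvPolynomial.eval v q =
        ∑ m ∈ q.support, (∏ i ∈ m.support, w i ^ m i) • q.coeff m := by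
      rw [MvPolynomial.eval_eq]
      refine Finset.sum_congr rfl fun m _ => ?_
      rw [Subfield.smul_def, smul_eq_mul, mul_comm]
      push_cast
      rfl
    rw [h1] at hv
    have h2 := congrArg (fun r => ((B.repr r j : F) : ℝ)) hv
    simp only [map_sum, map_smul, map_zero, Finsupp.coe_finsetSum, Finset.sum_apply,
      Finsupp.smul_apply, Finsupp.coe_zero, Pi.zero_apply] at h2
    rw [hg, ← (show ((0 : F) : ℝ) = 0 from rfl), ← h2]
    push_cast
    refine Finset.sum_congr rfl fun m _ => ?_
    rw [smul_eq_mul, mul_comm]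
    push_cast
    rfl

/-- Membership of a triangle `{u, v, y}` in an algebraic hypergraph is given by one polynomial in
the coordinates of `u` and `v`, the product of the specializations of `p` over all orderings of the
three points. -/
theorem IsAlgebraicHypergraph.exists_polynomial (hΓ : IsAlgebraicHypergraph Γ) (y : Euc d) :
    ∃ q : MvPolynomial (Fin d ⊕ Fin d) ℝ, ∀ u v : Euc d, {u, v, y} ∈ Γ ↔
      u ≠ v ∧ u ≠ y ∧ v ≠ y ∧ MvPolynomial.eval (Sum.elim (fun i => u i) fun i => v i) q = 0 := by
  obtain ⟨p, hp⟩ := hΓ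
  let V : Fin 3 → Fin d → MvPolynomial (Fin d ⊕ Fin d) ℝ :=
    ![fun i => MvPolynomial.X (Sum.inl i), fun i => MvPolynomial.X (Sum.inr i),
      fun i => MvPolynomial.C (y i)]
  refine ⟨∏ τ : Equiv.Perm (Fin 3), MvPolynomial.bind₁ (fun k => V (τ k.1) k.2) p, fun u v => ?_⟩
  have hV : ∀ k i, MvPolynomial.eval (Sum.elim (fun i => u i) fun i => v i) (V k i) =
      (![u, v, y] k) i := by
    intro k i
    fin_cases k <;> simp [V]
  have heval : ∀ τ : Equiv.Perm (Fin 3), MvPolynomial.eval (Sum.elim (fun i => u i) fun i => v i)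
      (MvPolynomial.bind₁ (fun k => V (τ k.1) k.2) p) =
      MvPolynomial.eval (fun k => (![u, v, y] (τ k.1)) k.2) p := by
    intro τ
    rw [MvPolynomial.eval, MvPolynomial.eval₂Hom_bind₁]
    congr 2
    funext k
    exact hV _ _
  have hrange : Set.range ![u, v, y] = {u, v, y} := by
    ext w
    constructor
    · rintro ⟨k, rfl⟩
      fin_cases k <;> simp
    · rintro (rfl | rfl | rfl)
      exacts [⟨0, rfl⟩, ⟨1, rfl⟩, ⟨2, rfl⟩]
  rw [map_prod, Finset.prod_eq_zero_iff, hp]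
  simp only [Finset.mem_univ, true_and, heval]
  constructor
  · rintro ⟨x, hx, hxr, hx0⟩
    choose τ hτ using fun k => (show x k ∈ Set.range ![u, v, y] by
      rw [hrange, ← hxr]; exact Set.mem_range_self k)
    have hτi : Function.Injective τ := fun k l h => hx (by rw [← hτ, ← hτ, h])
    let τ' : Equiv.Perm (Fin 3) := Equiv.ofBijective τ (Finite.injective_iff_bijective.mp hτi)
    have hinj : Function.Injective ![u, v, y] := by
      have : ![u, v, y] = x ∘ τ'.symm := by
        funext k
        rw [Function.comp_apply, ← hτ]
        congr 1
        exact (τ'.apply_symm_apply k).symm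
      rw [this]
      exact hx.comp τ'.symm.injective
    refine ⟨hinj.ne (show (0 : Fin 3) ≠ 1 by decide), hinj.ne (show (0 : Fin 3) ≠ 2 by decide),
      hinj.ne (show (1 : Fin 3) ≠ 2 by decide), τ', ?_⟩
    rw [← hx0]
    congr 2
    funext k
    exact congrArg (fun z : Euc d => z k.2) (hτ k.1)
  · rintro ⟨huv, huy, hvy, τ, hτ⟩
    have hinj : Function.Injective ![u, v, y] := by
      intro k l
      fin_cases k <;> fin_cases l <;> simp [huv, huy, hvy, huv.symm, huy.symm, hvy.symm]
    refine ⟨![u, v, y] ∘ τ, hinj.comp τ.injective, ?_, hτ⟩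
    rw [τ.surjective.range_comp, hrange]

/-- A point `y` with a coordinate outside of `F` has a neighborhood in which it forms no hyperedge
with two points with coordinates in `F`.

The pairs of points with coordinates in `F` which form a hyperedge with `y` are among the zeros of
finitely many polynomials over `F`, and all such zeros form a hyperedge with `y` if the three points
are distinct. If these zeros accumulate at the pair `(y, y)`, then by definability over `F` they
accumulate at some pair `(z, z)` with `z ≠ y` and the coordinates of `z` in `F`. The resulting
hyperedges converge to `{z, y}`, which contradicts irreflexivity. -/
theorem exists_radius_not_mem (hΓ : IsAlgebraicHypergraph Γ) (hirr : TwoIrreflexive 3 Γ)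
    {F : Subfield ℝ} (hF : ∀ c : ℝ, IsAlgebraic F c → c ∈ F) {y : Euc d} (hy : ¬ ∀ i, y i ∈ F) :
    ∃ δ > 0, ∀ u v : Euc d, (∀ i, u i ∈ F) → (∀ i, v i ∈ F) → dist u y < δ → dist v y < δ →
      {u, v, y} ∉ Γ := by
  by_contra! hcon
  obtain ⟨q, hq⟩ := hΓ.exists_polynomial y
  obtain ⟨Q, hQF, hQ1, hQ2⟩ := exists_components F q
  let W : (Fin d ⊕ Fin d → ℝ) → Prop := fun w =>
    ∀ g : Q, MvPolynomial.eval w (g : MvPolynomial _ ℝ) = 0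
  have hW : IsDefinable F W :=
    .forall_mem fun g => .eq (.eval fun m _ => hQF g g.2 m) .zero
  -- `N z` says that pairs of distinct points satisfying `W` come arbitrarily close to `(z, z)`
  let N : (Fin d → ℝ) → Prop := fun z => ∀ ε : Unit → ℝ, 0 < ε () → ∃ w : Fin d ⊕ Fin d → ℝ,
    ((∀ i, w (Sum.inl i) < z i + ε () ∧ z i - ε () < w (Sum.inl i)) ∧
    (∀ i, w (Sum.inr i) < z i + ε () ∧ z i - ε () < w (Sum.inr i))) ∧
    (∃ i, ¬ w (Sum.inl i) = w (Sum.inr i)) ∧ W w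
  have hN : IsDefinable F N := by
    refine .all (.imp (.lt .zero (.var _)) (.ex (.and (.and ?_ ?_) (.and ?_ ?_))))
    · exact .forall_mem fun i => .and (.lt (.var _) (.add (.var _) (.var _)))
        (.lt (.sub (.var _) (.var _)) (.var _))
    · exact .forall_mem fun i => .and (.lt (.var _) (.add (.var _) (.var _)))
        (.lt (.sub (.var _) (.var _)) (.var _))
    · exact .exists_mem fun i => .not (.eq (.var _) (.var _))
    · exact hW.comp Sum.inr
  have hcoord : ∀ (u : Euc d) (ε : ℝ), dist u y < ε → ∀ i, u i < y i + ε ∧ y i - ε < u i := by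
    intro u ε hu i
    have h1 : |u i - y i| < ε := by
      refine lt_of_le_of_lt ?_ hu
      rw [dist_eq_norm]
      exact PiLp.norm_apply_le (u - y) i
    rw [abs_lt] at h1
    constructor <;> linarith
  have hNy : N fun i => y i := by
    intro ε hε
    obtain ⟨u, v, huF, hvF, hu, hv, he⟩ := hcon (ε ()) hε
    obtain ⟨huv, -, -, h0⟩ := (hq u v).mp he
    refine ⟨Sum.elim (fun i => u i) fun i => v i, ⟨hcoord u _ hu, hcoord v _ hv⟩, ?_, ?_⟩
    · by_contra! h
      exact huv (PiLp.ext h)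
    · exact fun g => hQ2 _ (by rintro (i | i); exacts [huF i, hvF i]) h0 g g.2
  obtain ⟨z, hzN, hzF⟩ := exists_mem_of_definable hF hN ⟨_, hNy⟩
  have hzy : WithLp.toLp 2 z ≠ y := by
    rintro rfl
    exact hy hzF
  obtain ⟨ε, hε, hsep⟩ := hirr.exists_radius (by norm_num)
    (fun e he => (hΓ.encard_eq he).le) hzy
  have hnhds : {w : Fin d → ℝ | dist (WithLp.toLp 2 w : Euc d) (WithLp.toLp 2 z) <
      min ε (dist y (WithLp.toLp 2 z))} ∈ 𝓝 z := by
    have hc : Continuous fun w : Fin d → ℝ => dist (WithLp.toLp 2 w : Euc d) (WithLp.toLp 2 z) :=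
      (PiLp.continuous_toLp 2 _).dist continuous_const
    refine hc.continuousAt.eventually_lt continuousAt_const ?_
    rw [dist_self]
    exact lt_min hε (dist_pos.mpr hzy.symm)
  obtain ⟨η, hη, hball⟩ := Metric.mem_nhds_iff.mp hnhds
  obtain ⟨w, ⟨hw1, hw2⟩, ⟨i, hi⟩, hwW⟩ := hzN (fun _ => η) hη
  have hclose : ∀ s : Fin d → ℝ, (∀ i, s i < z i + η ∧ z i - η < s i) →
      dist (WithLp.toLp 2 s : Euc d) (WithLp.toLp 2 z) < min ε (dist y (WithLp.toLp 2 z)) := by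
    intro s hs
    refine hball (show s ∈ _ from ?_)
    rw [Metric.mem_ball, dist_pi_lt_iff hη]
    intro i
    rw [Real.dist_eq, abs_lt]
    have := hs i
    constructor <;> linarith
  have hu := hclose (fun i => w (Sum.inl i)) hw1
  have hv := hclose (fun i => w (Sum.inr i)) hw2
  have hney : ∀ s : Euc d, dist s (WithLp.toLp 2 z) < min ε (dist y (WithLp.toLp 2 z)) → s ≠ y := by
    rintro s hs rfl
    exact lt_irrefl _ (hs.trans_le (min_le_right _ _))
  have hedge :
      {WithLp.toLp 2 fun i => w (Sum.inl i), WithLp.toLp 2 fun i => w (Sum.inr i), y} ∈ Γ := by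
    refine (hq _ _).mpr ⟨fun h => hi ?_, hney _ hu, hney _ hv, ?_⟩
    · exact congrArg (fun s : Euc d => s i) h
    · refine hQ1 _ fun g hg => ?_
      have : (Sum.elim (fun i => w (Sum.inl i)) fun i => w (Sum.inr i)) = w := by
        ext (j | j) <;> rfl
      rw [← hwW ⟨g, hg⟩]
      exact congrArg (fun s => MvPolynomial.eval s g) this
  refine hsep _ hedge ?_ ⟨_, Or.inl rfl, hu.trans_le (min_le_left _ _)⟩
    ⟨y, by simp, by simpa using hε⟩
  rintro s (rfl | rfl | rfl)
  · exact Or.inl (hu.trans_le (min_le_left _ _))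
  · exact Or.inl (hv.trans_le (min_le_left _ _))
  · exact Or.inr (by simpa using hε)

end Irreflexivity

/-! ### The ideal of sets of rationals -/

theorem MemIdeal.mono {A B : Set ℝ} (hB : MemIdeal B) (h : A ⊆ B) : MemIdeal A :=
  ⟨fun t ht => hB.1 t (h ht), fun y hy => hB.2 y (hy.mono (Filter.principal_mono.mpr h))⟩

theorem MemIdeal.union {A B : Set ℝ} (hA : MemIdeal A) (hB : MemIdeal B) : MemIdeal (A ∪ B) := by
  refine ⟨fun t ht => ht.elim (hA.1 t) (hB.1 t), fun y hy => ?_⟩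
  rw [accPt_iff_frequently] at hy
  rcases Filter.frequently_or_distrib.mp (hy.mono fun z hz =>
    hz.2.imp (fun h => (⟨hz.1, h⟩ : z ≠ y ∧ z ∈ A)) fun h => (⟨hz.1, h⟩ : z ≠ y ∧ z ∈ B)) with h | h
  · exact hA.2 y (accPt_iff_frequently.mpr h)
  · exact hB.2 y (accPt_iff_frequently.mpr h)

theorem memIdeal_of_forall_eq_pow {A : Set ℝ} (hA : ∀ t ∈ A, ∃ k : ℕ, t = (1 / 2) ^ k) :
    MemIdeal A := by
  refine ⟨fun t ht => ?_, fun y hy => ?_⟩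
  · obtain ⟨k, rfl⟩ := hA t ht
    exact ⟨(1 / 2) ^ k, by positivity, by push_cast; rfl⟩
  · by_contra hne
    have hpos : 0 < |y| / 2 := by positivity
    obtain ⟨N, hN⟩ := exists_pow_lt_of_lt_one hpos (by norm_num : (1 / 2 : ℝ) < 1)
    refine Set.Infinite.of_accPt (hy.nhds_inter (Metric.ball_mem_nhds y hpos)) ?_
    refine ((Set.finite_lt_nat N).image fun k : ℕ => (1 / 2 : ℝ) ^ k).subset ?_
    rintro t ⟨hty, htA⟩
    obtain ⟨k, rfl⟩ := hA t htA
    refine ⟨k, ?_, rfl⟩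
    by_contra hk
    have h₁ : (1 / 2 : ℝ) ^ k ≤ (1 / 2) ^ N :=
      pow_le_pow_of_le_one (by norm_num) (by norm_num) (not_lt.mp hk)
    rw [Metric.mem_ball, dist_comm, Real.dist_eq] at hty
    have h₂ := abs_sub_abs_le_abs_sub y ((1 / 2 : ℝ) ^ k)
    rw [abs_of_pos (by positivity : (0 : ℝ) < (1 / 2) ^ k)] at h₂
    linarith

/-! ### Countable subfields -/

/-- A countable set of reals is included in a countable relatively algebraically closed
subfield. -/
theorem exists_countable_subfield {S : Set ℝ} (hS : S.Countable) :
    ∃ K : Subfield ℝ, S ⊆ K ∧ (K : Set ℝ).Countable ∧ ∀ c : ℝ, IsAlgebraic K c → c ∈ K := by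
  let K₀ := Subfield.closure S
  have hK₀ : Countable K₀ := by
    rw [← Cardinal.mk_le_aleph0_iff]
    exact (Subfield.cardinalMk_closure_le_max S).trans
      (max_le (Cardinal.le_aleph0_iff_set_countable.mpr hS) le_rfl)
  refine ⟨(algebraicClosure K₀ ℝ).toSubfield, fun s hs => ?_, ?_, fun c hc => ?_⟩
  · exact (algebraicClosure K₀ ℝ).algebraMap_mem ⟨s, Subfield.subset_closure hs⟩
  · refine (Algebraic.countable K₀ ℝ).mono fun c hc => ?_
    exact mem_algebraicClosure_iff.mp hc
  · have hc' : IsAlgebraic (algebraicClosure K₀ ℝ) c := hc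
    exact mem_algebraicClosure_iff.mpr (hc'.restrictScalars K₀)

theorem exists_isAlgebraic_of_iSup {K : ℕ → Subfield ℝ} (hK : Monotone K) {c : ℝ}
    (hc : IsAlgebraic (⨆ i, K i : Subfield ℝ) c) : ∃ i, IsAlgebraic (K i) c := by
  obtain ⟨P, hP, hPc⟩ := hc
  have hmem : ∀ n, ∃ i, (P.coeff n : ℝ) ∈ K i := fun n =>
    (Subfield.mem_iSup_of_directed hK.directed_le).mp (P.coeff n).2
  choose i hi using hmem
  let N := P.support.sup i
  have hlift : P.map (algebraMap _ ℝ) ∈ Polynomial.lifts (algebraMap (K N) ℝ) := by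
    rw [Polynomial.lifts_iff_coeff_lifts]
    intro n
    rw [Polynomial.coeff_map]
    by_cases hn : n ∈ P.support
    · exact ⟨⟨_, hK (Finset.le_sup hn) (hi n)⟩, rfl⟩
    · rw [Polynomial.notMem_support_iff.mp hn]
      exact ⟨0, by simp⟩
  obtain ⟨Q, hQ⟩ := (Polynomial.mem_lifts _).mp hlift
  refine ⟨N, Q, ?_, ?_⟩
  · rintro rfl
    rw [Polynomial.map_zero] at hQ
    exact hP ((Polynomial.map_eq_zero_iff (FaithfulSMul.algebraMap_injective _ ℝ)).mp hQ.symm)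
  · rw [Polynomial.aeval_def, ← Polynomial.eval_map] at hPc ⊢
    rw [hQ, hPc]

/-! ### Balls as colors -/

theorem IsColor.isBounded {d : ℕ} {U : Set (Euc d)} (hU : IsColor U) : Bornology.IsBounded U := by
  obtain ⟨c, r, -, rfl⟩ := hU
  exact Metric.isBounded_ball

theorem exists_isColor_diam_eq {d : ℕ} (hd : 1 ≤ d) (y : Euc d) (k : ℕ) :
    ∃ U : Set (Euc d), IsColor U ∧ y ∈ U ∧ Metric.diam U = (1 / 2) ^ k := by
  have : NeZero d := ⟨by omega⟩
  have hdense : DenseRange fun c : Fin d → ℚ => (WithLp.toLp 2 fun i => (c i : ℝ) : Euc d) :=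
    ((WithLp.toLp_surjective 2).denseRange).comp
      (DenseRange.piMap fun _ : Fin d => (Rat.denseRange_cast : DenseRange ((↑) : ℚ → ℝ)))
      (PiLp.continuous_toLp 2 _)
  obtain ⟨c, hc⟩ := hdense.exists_dist_lt y (show (0 : ℝ) < (1 / 2) ^ (k + 1) by positivity)
  refine ⟨_, ⟨c, (1 / 2) ^ (k + 1), by positivity, rfl⟩, ?_, ?_⟩
  · rw [Metric.mem_ball]
    push_cast
    exact hc
  · rw [Metric.diam_ball_eq _ (by positivity)]
    push_cast
    ring

/-- The points of a countable set can be put in colors which are as small as desired and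
have pairwise different diameters, all of them powers of `1 / 2`. -/
theorem exists_injOn_color {d : ℕ} (hd : 1 ≤ d) {N : Set (Euc d)} (hN : N.Countable)
    {ρ : Euc d → ℝ} (hρ : ∀ y ∈ N, 0 < ρ y) :
    ∃ f : Euc d → Set (Euc d), Set.InjOn f N ∧
      ∀ y ∈ N, IsColor (f y) ∧ y ∈ f y ∧ Metric.diam (f y) < ρ y ∧
        ∃ k : ℕ, Metric.diam (f y) = (1 / 2) ^ k := by
  obtain ⟨n, hn⟩ := Set.countable_iff_exists_injOn.mp hN
  have hm : ∀ y, ∃ m : ℕ, y ∈ N → (1 / 2 : ℝ) ^ m < ρ y := fun y => by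
    by_cases hy : y ∈ N
    · obtain ⟨m, hm⟩ := exists_pow_lt_of_lt_one (hρ y hy) (by norm_num : (1 / 2 : ℝ) < 1)
      exact ⟨m, fun _ => hm⟩
    · exact ⟨0, fun h => absurd h hy⟩
  choose m hm using hm
  choose f hf using fun y => exists_isColor_diam_eq hd y (Nat.pair (n y) (m y))
  refine ⟨f, fun y hy z hz hyz => ?_, fun y hy => ⟨(hf y).1, (hf y).2.1, ?_, _, (hf y).2.2⟩⟩
  · have h := congrArg Metric.diam hyz
    rw [(hf y).2.2, (hf z).2.2] at h
    have h' := (pow_right_injective₀ (by norm_num : (0 : ℝ) < 1 / 2) (by norm_num)) h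
    exact hn hy hz (Nat.pair_eq_pair.mp h').1
  · rw [(hf y).2.2]
    exact (pow_le_pow_of_le_one (by norm_num) (by norm_num) (Nat.right_le_pair _ _)).trans_lt
      (hm y hy)

/-! ### The ordering -/

namespace Condition

variable {d : ℕ} {Γ : Set (Set (Euc d))}

theorem mem_dom_iff (p : Condition Γ) {x : Euc d} : x ∈ p.dom ↔ ∀ i, x i ∈ p.supp := by
  rw [dom, p.domain_color]
  rfl

theorem mem_supp_of_isAlgebraic (p : Condition Γ) {c : ℝ} (hc : IsAlgebraic p.supp c) :
    c ∈ p.supp :=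
  mem_of_isAlgebraic p.supp p.isRealClosed_supp hc

theorem dom_subset {p q : Condition Γ} (h : q ≤ p) : p.dom ⊆ q.dom :=
  fun x ⟨U, hU⟩ => ⟨U, h.1 x U hU⟩

theorem color_eq {p q : Condition Γ} (h : q ≤ p) {x : Euc d} (hx : x ∈ p.dom) :
    q.color x = p.color x := by
  obtain ⟨U, hU⟩ := hx
  rw [hU, h.1 x U hU]

theorem supp_le (hd : 1 ≤ d) {p q : Condition Γ} (h : q ≤ p) : p.supp ≤ q.supp := by
  intro c hc
  have hx : (WithLp.toLp 2 fun _ => c : Euc d) ∈ p.dom := p.mem_dom_iff.mpr fun _ => hc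
  exact q.mem_dom_iff.mp (dom_subset h hx) ⟨0, hd⟩

protected theorem le_refl (p : Condition Γ) : p ≤ p :=
  ⟨fun _ _ h => h, fun _ hx => absurd hx.1 hx.2, fun _ _ _ =>
    memIdeal_of_forall_eq_pow fun _ ⟨_, hx, _⟩ => absurd hx.1.1 hx.1.2⟩

/-- The parameters `a` of an instance of the third clause for `r ≤ p` are replaced, at the
points of the domain of the intermediate condition `q`, by parameters in its support. -/
protected theorem le_trans (hd : 1 ≤ d) {p q r : Condition Γ} (hrq : r ≤ q) (hqp : q ≤ p) :
    r ≤ p := by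
  have hpq := supp_le hd hqp
  refine ⟨fun x U hU => hrq.1 x U (hqp.1 x U hU), fun x hx U hU => ?_, fun a ha har => ?_⟩
  · by_cases hxq : x ∈ q.dom
    · exact hqp.2.1 x ⟨hxq, hx.2⟩ U (color_eq hrq hxq ▸ hU)
    · exact (hrq.2.1 x ⟨hx.1, hxq⟩ U hU).trans_le (eps_anti hpq x)
  · obtain ⟨a', ha', ha'q, hD⟩ := exists_finite_D_subset (d := d) hpq ha
    refine ((hrq.2.2 a ha har).union (hqp.2.2 a' ha' ha'q)).mono ?_
    rintro t ⟨x, ⟨hx, V, hV, hle⟩, U, hU, rfl⟩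
    by_cases hxq : x ∈ q.dom
    · have hc := color_eq hrq hxq
      exact Or.inr ⟨x, ⟨⟨hxq, hx.2⟩, V, hc ▸ hV,
        (eps_le_eps_of_subset (hD x (q.mem_dom_iff.mp hxq))).trans hle⟩, U, hc ▸ hU, rfl⟩
    · exact Or.inl ⟨x, ⟨⟨hx.1, hxq⟩, V, hV,
        (eps_anti (Set.union_subset_union_left _ hpq) x).trans hle⟩, U, hU, rfl⟩

theorem le_of_antitone (hd : 1 ≤ d) {p : ℕ → Condition Γ} (hp : ∀ i, p (i + 1) ≤ p i) {i j : ℕ}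
    (hij : i ≤ j) : p j ≤ p i :=
  Nat.le_induction (Condition.le_refl _) (fun j _ h => Condition.le_trans hd (hp j) h) j hij

/-- The union of a descending sequence of conditions is a lower bound of it. -/
theorem exists_le_of_antitone (hd : 1 ≤ d) (hΓ : IsAlgebraicHypergraph Γ) {p : ℕ → Condition Γ}
    (hp : ∀ i, p (i + 1) ≤ p i) : ∃ q : Condition Γ, ∀ i, q ≤ p i := by
  classical
  have hle : ∀ {i j}, i ≤ j → p j ≤ p i := fun hij => le_of_antitone hd hp hij
  have hmono : Monotone fun i => (p i).supp := fun i j hij => supp_le hd (hle hij)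
  let f : Euc d → Option (Set (Euc d)) := fun x =>
    if h : ∃ U i, (p i).color x = some U then some h.choose else none
  have huniq : ∀ {i j x U V}, (p i).color x = some U → (p j).color x = some V → U = V := by
    intro i j x U V hU hV
    have h₁ := (hle (le_max_left i j)).1 x U hU
    rw [(hle (le_max_right i j)).1 x V hV] at h₁
    exact (Option.some.inj h₁).symm
  have hf : ∀ {x U}, f x = some U ↔ ∃ i, (p i).color x = some U := by
    intro x U
    constructor
    · intro h
      by_cases hx : ∃ U i, (p i).color x = some U
      · have h' : f x = some hx.choose := dif_pos hx
        rw [h'] at h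
        exact Option.some.inj h ▸ hx.choose_spec
      · have h' : f x = none := dif_neg hx
        rw [h'] at h
        exact absurd h (by simp)
    · rintro ⟨i, hi⟩
      have hx : ∃ U i, (p i).color x = some U := ⟨U, i, hi⟩
      have h' : f x = some hx.choose := dif_pos hx
      obtain ⟨j, hj⟩ := hx.choose_spec
      rw [h', huniq hj hi]
  have hmem : ∀ {c : ℝ}, c ∈ (⨆ i, (p i).supp : Subfield ℝ) ↔ ∃ i, c ∈ (p i).supp :=
    Subfield.mem_iSup_of_directed hmono.directed_le
  -- finitely many elements of the union of the supports belong to one of them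
  have hbdd : ∀ a : Set ℝ, a.Finite → a ⊆ (⨆ i, (p i).supp : Subfield ℝ) → ∀ i, ∃ j, i ≤ j ∧
      a ⊆ (p j).supp := by
    intro a ha
    induction a, ha using Set.Finite.induction_on with
    | empty => exact fun _ i => ⟨i, le_rfl, Set.empty_subset _⟩
    | @insert c s _ _ ih =>
      intro hs i
      obtain ⟨k, hk⟩ := hmem.mp (hs (Set.mem_insert c s))
      obtain ⟨j, hj, hsj⟩ := ih ((Set.subset_insert c s).trans hs) (max i k)
      exact ⟨j, (le_max_left i k).trans hj,
        Set.insert_subset (hmono ((le_max_right i k).trans hj) hk) hsj⟩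
  let q : Condition Γ :=
    { color := f
      supp := ⨆ i, (p i).supp
      isPartialColoring :=
        { isColor := fun x U h => by
            obtain ⟨i, hi⟩ := hf.mp h
            exact (p i).isPartialColoring.isColor x U hi
          mem_color := fun x U h => by
            obtain ⟨i, hi⟩ := hf.mp h
            exact (p i).isPartialColoring.mem_color x U hi
          not_monochromatic := by
            rintro e he - ⟨U, hU⟩
            have hfin : e.Finite := Set.finite_of_encard_eq_coe (hΓ.encard_eq he)
            choose! k hk using fun x hx => hf.mp (hU x hx)
            obtain ⟨N, hN⟩ := (hfin.image k).bddAbove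
            have hcol : ∀ x ∈ e, (p N).color x = some U := fun x hx =>
              (hle (hN (Set.mem_image_of_mem k hx))).1 x U (hk x hx)
            exact (p N).isPartialColoring.not_monochromatic e he
              (fun x hx => ⟨U, hcol x hx⟩) ⟨U, hcol⟩ }
      countable_supp := by
        rw [Subfield.coe_iSup_of_directed hmono.directed_le]
        exact Set.countable_iUnion fun i => (p i).countable_supp
      isRealClosed_supp := isRealClosed_of_forall_isAlgebraic _ fun c hc => by
        obtain ⟨i, hi⟩ := exists_isAlgebraic_of_iSup hmono hc
        exact hmem.mpr ⟨i, (p i).mem_supp_of_isAlgebraic hi⟩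
      domain_color := by
        ext x
        constructor
        · rintro ⟨U, hU⟩ j
          obtain ⟨i, hi⟩ := hf.mp hU
          exact hmem.mpr ⟨i, (p i).mem_dom_iff.mp ⟨U, hi⟩ j⟩
        · intro hx
          obtain ⟨j, -, hj⟩ := hbdd (Set.range fun i => x i) (Set.finite_range _)
            (by rintro _ ⟨i, rfl⟩; exact hx i) 0
          obtain ⟨U, hU⟩ := (p j).mem_dom_iff.mpr fun i => hj ⟨i, rfl⟩
          exact ⟨U, hf.mpr ⟨j, hU⟩⟩ }
  refine ⟨q, fun i => ⟨fun x U hU => hf.mpr ⟨i, hU⟩, ?_, fun a ha haq => ?_⟩⟩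
  · rintro x ⟨-, hx⟩ U hU
    obtain ⟨j, hj⟩ := hf.mp hU
    rcases le_total i j with hij | hij
    · exact (hle hij).2.1 x ⟨⟨U, hj⟩, hx⟩ U hj
    · exact absurd ⟨U, (hle hij).1 x U hj⟩ hx
  · obtain ⟨j, hij, haj⟩ := hbdd a ha haq i
    refine ((hle hij).2.2 a ha haj).mono ?_
    rintro t ⟨x, ⟨⟨-, hx⟩, V, hV, hleV⟩, U, hU, rfl⟩
    obtain rfl : V = U := Option.some.inj (hV.symm.trans hU)
    -- outside of the domain of `p j`, the second clause of `p k ≤ p j` makes the ball small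
    have hxj : (p j).color x = some V := by
      by_contra hne
      obtain ⟨k, hk⟩ := hf.mp hV
      have hjk : j ≤ k := by
        by_contra! hkj
        exact hne ((hle hkj.le).1 x V hk)
      have hxj : x ∉ (p j).dom := fun ⟨W, hW⟩ => hne (huniq hk hW ▸ hW)
      refine absurd ((hle hjk).2.1 x ⟨⟨V, hk⟩, hxj⟩ V hk) (not_lt.mpr (le_trans ?_ hleV))
      exact eps_anti (Set.union_subset (hmono hij) haj) x
    exact ⟨x, ⟨⟨⟨V, hxj⟩, hx⟩, V, hxj, hleV⟩, V, hxj, rfl⟩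

/-- A condition extends to the points with coordinates in a countable real closed field
extending its support, if the new points get balls of pairwise different and sufficiently small
diameters. -/
theorem exists_le_mem_dom (hd : 1 ≤ d) (hΓ : IsAlgebraicHypergraph Γ)
    (hirr : TwoIrreflexive 3 Γ) (p : Condition Γ) (x : Euc d) :
    ∃ q : Condition Γ, q ≤ p ∧ x ∈ q.dom := by
  classical
  obtain ⟨K, hSK, hKc, hK⟩ := exists_countable_subfield
    (p.countable_supp.union (Set.countable_range fun i => x i))
  have hF : ∀ c : ℝ, IsAlgebraic p.supp c → c ∈ p.supp := fun c => p.mem_supp_of_isAlgebraic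
  have hFK : p.supp ≤ K := fun c hc => hSK (Or.inl hc)
  let N : Set (Euc d) := {y | (∀ i, y i ∈ K) ∧ ¬ ∀ i, y i ∈ p.supp}
  have hN : N.Countable := by
    have h := (Set.countable_univ_pi fun _ : Fin d => hKc).image
      (WithLp.toLp 2 : (Fin d → ℝ) → Euc d)
    refine h.mono fun y hy => ?_
    exact ⟨fun i => y i, fun i _ => hy.1 i, rfl⟩
  have hρ : ∀ y, ∃ ρ : ℝ, y ∈ N → 0 < ρ ∧ ENNReal.ofReal ρ < eps Γ (p.supp : Set ℝ) y ∧
      ∀ u v : Euc d, (∀ i, u i ∈ p.supp) → (∀ i, v i ∈ p.supp) → dist u y < ρ → dist v y < ρ →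
        {u, v, y} ∉ Γ := by
    intro y
    by_cases hy : y ∈ N
    · obtain ⟨r, hr, hr'⟩ := ENNReal.lt_iff_exists_nnreal_btwn.mp (eps_pos hΓ hirr hF hy.2)
      obtain ⟨δ, hδ, hsep⟩ := exists_radius_not_mem hΓ hirr hF hy.2
      refine ⟨min r δ, fun _ => ⟨lt_min (by exact_mod_cast hr) hδ, ?_, ?_⟩⟩
      · refine lt_of_le_of_lt (ENNReal.ofReal_le_ofReal (min_le_left _ _)) ?_
        rwa [ENNReal.ofReal_coe_nnreal]
      · exact fun u v hu hv h₁ h₂ => hsep u v hu hv (h₁.trans_le (min_le_right _ _))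
          (h₂.trans_le (min_le_right _ _))
    · exact ⟨0, fun h => absurd h hy⟩
  choose ρ hρ using hρ
  obtain ⟨f, hinj, hf⟩ := exists_injOn_color hd hN fun y hy => (hρ y hy).1
  let g : Euc d → Option (Set (Euc d)) := fun y => if y ∈ N then some (f y) else p.color y
  have hgN : ∀ {y}, y ∈ N → g y = some (f y) := fun hy => if_pos hy
  have hgp : ∀ {y}, y ∉ N → g y = p.color y := fun hy => if_neg hy
  have hdomp : ∀ {y}, y ∈ p.dom → y ∉ N := fun hy hyN => hyN.2 (p.mem_dom_iff.mp hy)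
  have hcolor : ∀ y U, g y = some U → IsColor U ∧ y ∈ U := by
    intro y U h
    by_cases hy : y ∈ N
    · rw [hgN hy] at h
      obtain rfl := Option.some.inj h
      exact ⟨(hf y hy).1, (hf y hy).2.1⟩
    · rw [hgp hy] at h
      exact ⟨p.isPartialColoring.isColor y U h, p.isPartialColoring.mem_color y U h⟩
  let q : Condition Γ :=
    { color := g
      supp := K
      isPartialColoring :=
        { isColor := fun y U h => (hcolor y U h).1
          mem_color := fun y U h => (hcolor y U h).2
          not_monochromatic := by
            rintro e he - ⟨U, hU⟩
            by_cases hnew : ∃ y ∈ e, y ∈ N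
            · -- a monochromatic hyperedge has at most one new point, as their colors differ
              obtain ⟨y, hye, hyN⟩ := hnew
              have hUy : f y = U := Option.some.inj ((hgN hyN).symm.trans (hU y hye))
              have hold : ∀ z ∈ e, z ≠ y → (∀ i, z i ∈ p.supp) ∧ dist z y < ρ y := by
                intro z hz hzy
                have hzN : z ∉ N := fun hzN => hzy (hinj hzN hyN
                  ((Option.some.inj ((hgN hzN).symm.trans (hU z hz))).trans hUy.symm))
                have hzU := hU z hz
                rw [hgp hzN] at hzU
                refine ⟨p.mem_dom_iff.mp ⟨U, hzU⟩, ?_⟩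
                have hb := (hf y hyN).1.isBounded
                refine (Metric.dist_le_diam_of_mem hb ?_ (hf y hyN).2.1).trans_lt (hf y hyN).2.2.1
                rw [hUy]
                exact p.isPartialColoring.mem_color z U hzU
              have hcard : (e \ {y}).encard = 2 := by
                rw [Set.encard_sdiff_singleton_of_mem hye, hΓ.encard_eq he]
                rfl
              obtain ⟨u, v, -, huv⟩ := Set.encard_eq_two.mp hcard
              have hu : u ∈ e \ {y} := by rw [huv]; simp
              have hv : v ∈ e \ {y} := by rw [huv]; simp
              have hedge : e = {u, v, y} := by
                rw [← Set.insert_sdiff_self_of_mem hye, huv]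
                ext z
                simp only [Set.mem_insert_iff, Set.mem_singleton_iff]
                tauto
              obtain ⟨hu₁, hu₂⟩ := hold u hu.1 hu.2
              obtain ⟨hv₁, hv₂⟩ := hold v hv.1 hv.2
              exact (hρ y hyN).2.2 u v hu₁ hv₁ hu₂ hv₂ (hedge ▸ he)
            · have hcol : ∀ z ∈ e, p.color z = some U := fun z hz =>
                hgp (fun h => hnew ⟨z, hz, h⟩) ▸ hU z hz
              exact p.isPartialColoring.not_monochromatic e he
                (fun z hz => ⟨U, hcol z hz⟩) ⟨U, hcol⟩ }
      countable_supp := hKc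
      isRealClosed_supp := isRealClosed_of_forall_isAlgebraic K hK
      domain_color := by
        ext y
        constructor
        · rintro ⟨U, hU⟩
          by_cases hy : y ∈ N
          · exact hy.1
          · rw [hgp hy] at hU
            exact fun i => hFK (p.mem_dom_iff.mp ⟨U, hU⟩ i)
        · intro hyK
          by_cases hy : ∀ i, y i ∈ p.supp
          · obtain ⟨U, hU⟩ := p.mem_dom_iff.mpr hy
            exact ⟨U, (hgp fun h => h.2 hy).trans hU⟩
          · exact ⟨f y, hgN ⟨hyK, hy⟩⟩ }
  have hq : ∀ {y U}, y ∈ q.dom \ p.dom → q.color y = some U → y ∈ N ∧ f y = U := by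
    intro y U hy hU
    have hyN : y ∈ N := ⟨q.mem_dom_iff.mp hy.1, fun h => hy.2 (p.mem_dom_iff.mpr h)⟩
    exact ⟨hyN, Option.some.inj ((hgN hyN).symm.trans hU)⟩
  refine ⟨q, ⟨fun y U hU => (hgp (hdomp ⟨U, hU⟩)).trans hU, fun y hy U hU => ?_,
    fun a _ _ => memIdeal_of_forall_eq_pow ?_⟩, q.mem_dom_iff.mpr fun i => hSK (Or.inr ⟨i, rfl⟩)⟩
  · obtain ⟨hyN, rfl⟩ := hq hy hU
    exact (ENNReal.ofReal_le_ofReal (hf y hyN).2.2.1.le).trans_lt (hρ y hyN).2.1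
  · rintro t ⟨y, ⟨hy, -⟩, U, hU, rfl⟩
    obtain ⟨hyN, rfl⟩ := hq hy hU
    exact (hf y hyN).2.2.2

end Condition

end ColoringPoset

theorem mainTheorem10 (d : ℕ) (hd : 1 ≤ d) (Γ : Set (Set (ColoringPoset.Euc d)))
    (hΓ : ColoringPoset.IsAlgebraicHypergraph Γ)
    (hirr : ColoringPoset.TwoIrreflexive 3 Γ) :
    (∀ p q r : ColoringPoset.Condition Γ, r ≤ q → q ≤ p → r ≤ p) ∧
    (∀ p : ℕ → ColoringPoset.Condition Γ, (∀ i, p (i + 1) ≤ p i) →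
      ∃ q : ColoringPoset.Condition Γ, ∀ i, q ≤ p i) ∧
    (∀ (p : ColoringPoset.Condition Γ) (x : ColoringPoset.Euc d),
      ∃ q : ColoringPoset.Condition Γ, q ≤ p ∧ x ∈ q.dom) := by
  refine ⟨fun p q r hrq hqp => ColoringPoset.Condition.le_trans hd hrq hqp, fun p hp => ?_,
    fun p x => ColoringPoset.Condition.exists_le_mem_dom hd hΓ hirr p x⟩
  exact ColoringPoset.Condition.exists_le_of_antitone hd hΓ hp
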